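/- Let $d(s,t)=d(t,s)$ be a symmetric distance function on objects, with values in an arbitrary totally ordered set (no triangle inequality or other property is assumed). The conga line data structure maintains a finite set $S$ of $n$ objects as a partition into nonempty subsets $S_1,\dots,S_k$, together with a digraph $G_i$ for each $S_i$, as follows; all free choices and ties may be resolved arbitrarily. * Creating $G_i$ for a new nonempty subset $S_i$: $G_i$ is a single directed path $P$. It starts at any object of $S_i$. While the last vertex of $P$ is in $S_i$, the next vertex is its nearest neighbour in $S\setminus P$; when the last vertex is in $S\setminus S_i$, the next vertex is its nearest neighbour in $S_i\setminus P$. The path ends when the respective set is empty. Nearest neighbours are found by testing all candidates. * Initialization: if $S\neq\emptyset$, $S_1=S$, and $G_1$ is created. * Merging: while $k>\log_2 n$ and $k\ge 2$, choose two subsets $S_i,S_j$ with $|S_i|\le|S_j|$ that minimize $|S_j|/|S_i|$, and replace them and their digraphs by $S_i\cup S_j$ with a newly created digraph. * Inserting $x\notin S$: add $x$ to $S$, create the subset $\{x\}$ and its digraph, then merge. * Deleting $x\in S$: let $Y$ be the set of all $y$ such that $(y,x)$ is an edge of some $G_i$. Remove $x$ from $S$, remove $x$ and its incident edges from all digraphs,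 take $x$ and the objects of $Y$ out of their subsets, discard subsets that have become empty (with their digraphs), create the subset $Y$ (if nonempty) and its digraph, then merge. * At the end of every update, if all digraphs together have at least $2n$ edges, rebuild: replace the structure by the single subset $S$ (if nonempty) with a newly created digraph. Then find the answer by scanning all edges for one of minimum length. Count as one step the evaluation of $d$, the comparison of two distances, the comparison of two objects for equality, an operation on a list cell, and an arithmetic operation on small integers; measure space in list cells, an object taking constant space. Theorem. There is an absolute constant $C$ such that for every $d$, every finite initial set $S_0$, every sequence of insertions of new objects and deletions of present objects, and every resolution of the free choices: 1. after initialization and after every update, the subsets form a partition of the current set $S$ into nonempty subsets, with $k\le\log_2 n$ whenever $n\ge2$; every $G_i$ is a union of disjoint directed paths on objects of $S$; and the answer is a pair of distinct objects $s,t\in S$ with $d(s,t)$ minimum (if $n\ge 2$; no pair is returned if $n\le1$); 2. the space used is at most $C(n+1)$, between updates and during an update, where $n$ is the size of $S$ before the update; 3. the amortized time is $O(n\log n)$ per insertion and $O(n\log^2n)$ per deletion: the total time of the updates of the sequence is at most $$C\Bigl(\sum_{\text{insertions}} n\log_2(n+1)+\sum_{\text{deletions}} n\log_2^2(n+1)\Bigr),$$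 where $n$ is the number of objects present at the time of the update, including the object inserted or deleted. (Initialization takes time at most $C(|S_0|+1)^2$ and space at most $C(|S_0|+1)$.) -/

import Mathlib

universe u v

namespace CongaLine

/-! ### Programs with nondeterministic choices, a step count and a memory count -/

/-- Resources used by a computation: the number of elementary steps, and the largest number of
memory cells that were in use at some moment. -/
structure Cost where
  time : ℕ
  space : ℕ

/-- A nondeterministic program, given by its possible outcomes: `m a c` says that some way of
making the free choices lets `m` return `a` using the resources `c`. -/
def Prog (γ : Type u) : Type u := γ → Cost → Prop

/-- `m` can return `a` with cost `c`. -/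
def Prog.Yields {γ : Type u} (m : Prog γ) (a : γ) (c : Cost) : Prop := m a c

/-- Sequential composition adds the times and takes the maximum of the memory peaks. -/
instance : Monad Prog.{u} where
  pure a := fun b c => b = a ∧ c = ⟨0, 0⟩
  bind m f := fun b c => ∃ a c₁ c₂, m.Yields a c₁ ∧ (f a).Yields b c₂ ∧
    c = ⟨c₁.time + c₂.time, max c₁.space c₂.space⟩

/-- Spend `t` elementary steps. An elementary step is: visiting, creating or releasing a list
cell; testing whether two objects are equal; one arithmetic operation or comparison on numbers
of size polynomial in `n`; evaluating the distance function; comparing two distances. -/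
def charge (t : ℕ) : Prog PUnit.{u + 1} := fun _ c => c = ⟨t, 0⟩

/-- Record that `s` memory cells are in use at this moment. -/
def live (s : ℕ) : Prog PUnit.{u + 1} := fun _ c => c = ⟨0, s⟩

/-- Return an arbitrary element of `A`. -/
def choose {γ : Type u} (A : Set γ) : Prog γ := fun a c => a ∈ A ∧ c = ⟨0, 0⟩

/-- Scan a list for an element of minimum key, keeping the best candidate so far; ties are
resolved arbitrarily. Per element: one list cell, two key evaluations, one comparison. -/
def argmin {γ : Type u} {β : Type v} [LinearOrder β] (key : γ → β) : γ → List γ → Prog γ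
  | best, [] => do
      charge 1
      pure best
  | best, z :: l => do
      charge 4
      let best' ← choose {y | (y = best ∧ key best ≤ key z) ∨ (y = z ∧ key z ≤ key best)}
      argmin key best' l

/-! ### The data structure -/

/-- A subset `S_i` of the partition, with the edges of its digraph `G_i`. -/
structure Part (α : Type u) where
  pts : List α
  edges : List (α × α)

/-- The objects `S`, the parts `(S_i, G_i)`, and the current answer. -/
structure Conga (α : Type u) where
  objs : List α
  parts : List (Part α)
  best : Option (α × α)

section

variable {α : Type u} [DecidableEq α] {β : Type v} [LinearOrder β]

/-- All edges of all the digraphs. -/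
def allEdges (ps : List (Part α)) : List (α × α) := ps.flatMap Part.edges

/-- All objects in the parts. -/
def allPts (ps : List (Part α)) : List α := ps.flatMap Part.pts

/-- Number of memory cells for a list of parts. -/
def partsCells (ps : List (Part α)) : ℕ :=
  (allPts ps).length + (allEdges ps).length + ps.length

/-- Number of memory cells for the whole structure. -/
def Conga.cells (σ : Conga α) : ℕ := σ.objs.length + partsCells σ.parts + 1

/-- Extend the path under construction as long as possible. Here `I = S_i`, `restS = S \ P`,
`restI = S_i \ P`, `last` is the last vertex of the path `P`, and `E` holds the edges found so
far; `base` is the number of cells occupied by the rest of the structure. If `last ∈ S_i` the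
next vertex is a nearest neighbour of `last` in `S \ P`, otherwise one in `S_i \ P`; the path
ends when the respective set is empty. The first argument bounds the number of rounds; it is
started at `|S|`, which is never exceeded. -/
def extend (d : α → α → β) (base : ℕ) (I : List α) :
    ℕ → List α → List α → α → List (α × α) → Prog (List (α × α))
  | 0, _, _, _, E => pure E
  | fuel + 1, restS, restI, last, E => do
      live (base + I.length + restS.length + restI.length + E.length + 1)
      charge (I.length + 1)
      match (if last ∈ I then restS else restI) with
      | [] => pure E
      | z :: l => do
          let w ← argmin (d last) z l
          charge (restS.length + restI.length + 1)
          extend d base I fuel (restS.erase w) (restI.erase w) w ((last, w) :: E)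

/-- Create the part with object set `I` (if nonempty) among the objects `S`, with its digraph,
and add it to the parts `ps`. The path starts at an arbitrary object of `I`. -/
def addPart (d : α → α → β) (S I : List α) (ps : List (Part α)) : Prog (List (Part α)) :=
  if I = [] then do
    charge 1
    pure ps
  else do
    let v ← choose {v | v ∈ I}
    charge (S.length + I.length + 1)
    let E ← extend d (S.length + partsCells ps) I S.length (S.erase v) (I.erase v) v []
    pure (⟨I, E⟩ :: ps)

/-- `A` and `B` are two different entries of `ps`, and `rest` are the other ones. -/
def IsSplit (ps : List (Part α)) (A B : Part α) (rest : List (Part α)) : Prop :=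
  ps.Perm (A :: B :: rest) ∧ rest.Sublist ps

/-- Two parts `|A| ≤ |B|` that minimize the size ratio `|B| / |A|`, with the remaining parts. -/
def IsBestSplit (ps : List (Part α)) (A B : Part α) (rest : List (Part α)) : Prop :=
  IsSplit ps A B rest ∧ A.pts.length ≤ B.pts.length ∧
    ∀ A' B' rest', IsSplit ps A' B' rest' → A'.pts.length ≤ B'.pts.length →
      (B.pts.length : ℚ) / A.pts.length ≤ (B'.pts.length : ℚ) / A'.pts.length

/-- Merge parts until there are at most `log₂ n` of them (or only one). The best pair to merge is
found by testing all pairs. The first argument bounds the number of rounds; it is started at the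
number of parts, which is never exceeded. -/
def mergeParts (d : α → α → β) (S : List α) : ℕ → List (Part α) → Prog (List (Part α))
  | 0, ps => pure ps
  | fuel + 1, ps => do
      charge (S.length + ps.length + Nat.log 2 S.length + 1)
      if ps.length ≤ Nat.log 2 S.length ∨ ps.length ≤ 1 then
        pure ps
      else do
        charge (ps.length ^ 2 + (allPts ps).length)
        let r ← choose {r : Part α × Part α × List (Part α) | IsBestSplit ps r.1 r.2.1 r.2.2}
        let ps' ← addPart d S (r.1.pts ++ r.2.1.pts) r.2.2
        mergeParts d S fuel ps'

/-- If there are at least `2n` edges, move all objects to a single part with a new digraph. -/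
def rebuildIfNeeded (d : α → α → β) (S : List α) (ps : List (Part α)) :
    Prog (List (Part α)) := do
  charge (S.length + (allEdges ps).length + ps.length + 1)
  if 2 * S.length ≤ (allEdges ps).length then
    addPart d S S []
  else
    pure ps

/-- Find the answer by scanning all edges. -/
def scan (d : α → α → β) (S : List α) (ps : List (Part α)) : Prog (Conga α) := do
  charge (ps.length + 1)
  live (S.length + partsCells ps + 1)
  match allEdges ps with
  | [] => pure ⟨S, ps, none⟩
  | e :: l => do
      let e' ← argmin (fun e => d e.1 e.2) e l
      pure ⟨S, ps, some e'⟩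

/-- Initialization with the list `S` of initial objects, all of them in one part. -/
def initStruct (d : α → α → β) (S : List α) : Prog (Conga α) := do
  let ps ← addPart d S S []
  scan d S ps

/-- What an update does once the set of objects has changed: create the part for `I`, merge,
rebuild if there are too many edges, and find the closest pair. -/
def finish (d : α → α → β) (S I : List α) (ps : List (Part α)) : Prog (Conga α) := do
  let ps₁ ← addPart d S I ps
  let ps₂ ← mergeParts d S ps₁.length ps₁
  let ps₃ ← rebuildIfNeeded d S ps₂
  scan d S ps₃

/-- Insertion of `x`: the new part is `{x}`. -/
def insertObj (d : α → α → β) (x : α) (σ : Conga α) : Prog (Conga α) := do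
  charge 1
  live (σ.cells + 1)
  finish d (x :: σ.objs) [x] σ.parts

/-- The sources of the edges into `x`, with repetitions. -/
def preds (x : α) (ps : List (Part α)) : List α :=
  ((allEdges ps).filter (fun e => decide (e.2 = x))).map Prod.fst

/-- Remove `x` with its incident edges from all digraphs, remove `x` and the objects of `Y` from
their parts, and drop the parts that have become empty. -/
def detach (x : α) (Y : List α) (ps : List (Part α)) : List (Part α) :=
  (ps.map fun p => (⟨p.pts.filter (fun y => decide (y ≠ x ∧ y ∉ Y)),
    p.edges.filter (fun e => decide (e.1 ≠ x ∧ e.2 ≠ x))⟩ : Part α)).filter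
      (fun p => !p.pts.isEmpty)

/-- Deletion of `x`: the new part consists of all `y` with an edge `(y, x)` in some digraph. -/
def deleteObj (d : α → α → β) (x : α) (σ : Conga α) : Prog (Conga α) := do
  let Y := preds x σ.parts
  live (σ.cells + 2 * Y.length)
  charge ((allEdges σ.parts).length + σ.parts.length + 1)
  charge (Y.length ^ 2 + σ.objs.length + 1)
  charge ((allPts σ.parts).length * (Y.length + 2) + 3 * (allEdges σ.parts).length +
    2 * σ.parts.length + 1)
  finish d (σ.objs.erase x) Y.dedup (detach x Y σ.parts)

end

/-! ### Sequences of updates -/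

/-- An update of the set of objects. -/
inductive Op (α : Type u) where
  | insert (x : α)
  | delete (x : α)

section

variable {α : Type u} [DecidableEq α] {β : Type v} [LinearOrder β]

/-- The effect of an update on the set `S`. -/
def Op.apply : Op α → Finset α → Finset α
  | .insert x, S => Insert.insert x S
  | .delete x, S => S.erase x

/-- New objects are inserted, present objects are deleted. -/
def Op.Valid : Op α → Finset α → Prop
  | .insert x, S => x ∉ S
  | .delete x, S => x ∈ S

/-- The set after a sequence of updates. -/
def applyAll : Finset α → List (Op α) → Finset α
  | S, [] => S
  | S, op :: ops => applyAll (op.apply S) ops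

/-- Every update of the sequence is valid when it is performed. -/
def ValidAll : Finset α → List (Op α) → Prop
  | _, [] => True
  | S, op :: ops => op.Valid S ∧ ValidAll (op.apply S) ops

/-- The time bound claimed for one update, up to a constant factor: `n log n` for an insertion
and `n log² n` for a deletion, where `n ≥ 1` is the number of objects including the one inserted
or deleted (and `log (n + 1)` is used in place of `log n` because of `n = 1`). -/
noncomputable def Op.bound : Op α → Finset α → ℝ
  | .insert _, S => ((S.card : ℝ) + 1) * Real.logb 2 ((S.card : ℝ) + 2)
  | .delete _, S => (S.card : ℝ) * Real.logb 2 ((S.card : ℝ) + 1) ^ 2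

/-- The sum of the bounds over a sequence of updates. -/
noncomputable def boundAll : Finset α → List (Op α) → ℝ
  | _, [] => 0
  | S, op :: ops => op.bound S + boundAll (op.apply S) ops

/-- Perform one update on the data structure. -/
def update (d : α → α → β) : Op α → Conga α → Prog (Conga α)
  | .insert x, σ => insertObj d x σ
  | .delete x, σ => deleteObj d x σ

/-- Perform a sequence of updates on the data structure. -/
def execute (d : α → α → β) : List (Op α) → Conga α → Prog (Conga α)
  | [], σ => pure σ
  | op :: ops, σ => do
      let σ' ← update d op σ
      execute d ops σ'

/-! ### What is claimed about a state -/

/-- The edges form a union of disjoint directed paths, i.e. a subgraph of one directed path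
without repeated vertices. -/
def IsPathUnion (E : List (α × α)) : Prop :=
  E.Nodup ∧ ∃ p : List α, p.Nodup ∧ ∀ e ∈ E, e ∈ p.zip p.tail

/-- The state represents the set `S`, partitioned into nonempty parts, of which there are at most
`log₂ n` when `n ≥ 2`; every digraph is a union of paths on objects of `S`. -/
def Conga.Represents (σ : Conga α) (S : Finset α) : Prop :=
  σ.objs.Nodup ∧ σ.objs.toFinset = S ∧ (allPts σ.parts).Perm σ.objs ∧
  (∀ p ∈ σ.parts, p.pts ≠ [] ∧ IsPathUnion p.edges ∧ ∀ e ∈ p.edges, e.1 ∈ S ∧ e.2 ∈ S) ∧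
  (2 ≤ S.card → (σ.parts.length : ℝ) ≤ Real.logb 2 S.card)

/-- `r` is a closest pair of distinct objects of `S`, or `none` if there are no two objects. -/
def IsClosestPair (d : α → α → β) (S : Finset α) : Option (α × α) → Prop
  | none => S.card ≤ 1
  | some (s, t) => s ∈ S ∧ t ∈ S ∧ s ≠ t ∧ ∀ x ∈ S, ∀ y ∈ S, x ≠ y → d s t ≤ d x y

end

end CongaLine

/-! Correctness. Let `P` be the path built for a part `I` of `S`, and take `s ∈ I`, `t ∈ S`.
Whichever of the two comes first on `P` still had the other one among its candidates when its
successor was chosen, so the edge leaving it is no longer than `d s t`; and `P` cannot stop before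
reaching one of them. This is `Covers`. Objects inserted later always land in newer parts, so, with
parts listed newest first, each part keeps covering its pairs with itself and with older parts
(`Inv`). Every pair of distinct objects is thus dominated by an edge, and the shortest edge is a
closest pair. A dominating edge starts at an end of its pair. Deleting `x` therefore spoils
surviving pairs only through edges `(y, x)`, and all such `y` move to the newest part, which is
built against all of `S` (`Inv.detach`).

Cost. On a path for `I`, an object outside `I` can only be followed by one in `I`. So the path has
fewer than `2|I|` edges and takes time `O(n|I|)` (`extend_spec`, `addPart_spec`). With more than
`log₂ n` parts, pigeonhole on `⌊log₄ |S_i|⌋` gives two parts with size ratio at most 4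
(`IsBestSplit.le_four_mul`). Merging parts of sizes `a ≤ b ≤ 4a` raises `∑ |S_i| log₂ |S_i|` by at
least `a ≥ (a + b)/5`, so a potential of order `n (n log₂ n - ∑ |S_i| log₂ |S_i|)` pays for the
merge and for its new edges. A second term, of order `n` times the number of edges in excess of `n`,
pays for the quadratic rebuild.

Each digraph has at most one edge into `x`, so a deletion detaches at most `1 + log₂ n` objects when
`n ≥ 2`. Each of them lowers the sum by at most `log₂ n + 2`, which raises the potential by `O(n
log² n)`; an insertion raises it by `O(n log n)`. The potential is zero initially and never
negative, so the amortized bounds add up to the total time (`execute_spec`). -/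

namespace CongaLine

/-! ### Reasoning about programs -/

/-- `m` has an outcome, and every outcome of `m` satisfies `Q`. -/
def Prog.Spec {γ : Type u} (m : Prog γ) (Q : γ → Cost → Prop) : Prop :=
  (∃ a c, m.Yields a c) ∧ ∀ a c, m.Yields a c → Q a c

section

variable {γ δ : Type u} {m : Prog γ} {Q P : γ → Cost → Prop}

theorem Prog.Spec.mono (h : m.Spec P) (hPQ : ∀ a c, P a c → Q a c) : m.Spec Q :=
  ⟨h.1, fun a c hy => hPQ a c (h.2 a c hy)⟩

theorem Prog.spec_pure {a : γ} (h : Q a ⟨0, 0⟩) : (pure a : Prog γ).Spec Q := by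
  refine ⟨⟨a, ⟨0, 0⟩, rfl, rfl⟩, ?_⟩
  rintro b c ⟨rfl, rfl⟩
  exact h

theorem Prog.Spec.bind {f : γ → Prog δ} {R : δ → Cost → Prop} (h : m.Spec P)
    (hf : ∀ a c, P a c → (f a).Spec fun b c' => R b ⟨c.time + c'.time, max c.space c'.space⟩) :
    (m >>= f).Spec R := by
  obtain ⟨⟨a, c, hac⟩, h2⟩ := h
  refine ⟨?_, ?_⟩
  · obtain ⟨⟨b, c', hb⟩, -⟩ := hf a c (h2 a c hac)
    exact ⟨b, _, a, c, c', hac, hb, rfl⟩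
  · rintro b c ⟨a, c₁, c₂, ha, hb, rfl⟩
    exact (hf a c₁ (h2 a c₁ ha)).2 b c₂ hb

theorem Prog.spec_charge_bind {t : ℕ} {f : PUnit.{u + 1} → Prog γ}
    (h : (f ⟨⟩).Spec fun b c => Q b ⟨t + c.time, c.space⟩) : (charge t >>= f).Spec Q := by
  have h0 : (charge t).Spec fun _ c => c = ⟨t, 0⟩ := ⟨⟨⟨⟩, _, rfl⟩, fun _ _ h => h⟩
  refine h0.bind ?_
  rintro ⟨⟩ c rfl
  simpa using h

theorem Prog.spec_live_bind {s : ℕ} {f : PUnit.{u + 1} → Prog γ}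
    (h : (f ⟨⟩).Spec fun b c => Q b ⟨c.time, max s c.space⟩) : (live s >>= f).Spec Q := by
  have h0 : (live s).Spec fun _ c => c = ⟨0, s⟩ := ⟨⟨⟨⟩, _, rfl⟩, fun _ _ h => h⟩
  refine h0.bind ?_
  rintro ⟨⟩ c rfl
  simpa using h

/-- The one rule in which a program could get stuck: nonemptiness of the set of choices supplies the
existence half of `Spec`. -/
theorem Prog.spec_choose_bind {A : Set δ} {f : δ → Prog γ} (hA : A.Nonempty)
    (h : ∀ a ∈ A, (f a).Spec Q) : (choose A >>= f).Spec Q := by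
  have h0 : (choose A).Spec fun a c => a ∈ A ∧ c = ⟨0, 0⟩ :=
    ⟨⟨hA.some, _, hA.some_mem, rfl⟩, fun _ _ h => h⟩
  refine h0.bind ?_
  rintro a c ⟨ha, rfl⟩
  simpa using h a ha

end

/-! ### Scanning and building a path -/

section

variable {α : Type u} {β : Type v} [LinearOrder β]

theorem argmin_spec {γ : Type u} (key : γ → β) (l : List γ) : ∀ best : γ,
    (argmin key best l).Spec fun y c => y ∈ best :: l ∧ (∀ z ∈ best :: l, key y ≤ key z) ∧
      c.time = 4 * l.length + 1 ∧ c.space = 0 := by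
  induction l with
  | nil =>
    intro best
    refine Prog.spec_charge_bind (Prog.spec_pure ?_)
    simp
  | cons z l ih =>
    intro best
    refine Prog.spec_charge_bind (Prog.spec_choose_bind ?_ ?_)
    · rcases le_total (key best) (key z) with h | h
      · exact ⟨best, Or.inl ⟨rfl, h⟩⟩
      · exact ⟨z, Or.inr ⟨rfl, h⟩⟩
    · rintro y hy
      refine (ih y).mono ?_
      rintro w c ⟨hw, hmin, ht, hs⟩
      have hwy := hmin y (by simp)
      refine ⟨?_, ?_, ?_, hs⟩
      · rcases hy with ⟨rfl, -⟩ | ⟨rfl, -⟩ <;> simp only [List.mem_cons] at hw ⊢ <;> tauto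
      · intro t ht'
        simp only [List.mem_cons] at ht'
        rcases ht' with rfl | rfl | ht'
        · rcases hy with ⟨rfl, h⟩ | ⟨rfl, h⟩
          · exact hwy
          · exact hwy.trans h
        · rcases hy with ⟨rfl, h⟩ | ⟨rfl, h⟩
          · exact hwy.trans h
          · exact hwy
        · exact hmin t (by simp [ht'])
      · simp only [ht, List.length_cons]; ring

/-- Every pair of distinct objects `s ∈ A`, `t ∈ B` is dominated by an edge of `E` that leaves
`s` or `t`. -/
def Covers (d : α → α → β) (E : List (α × α)) (A B : List α) : Prop :=
  ∀ s ∈ A, ∀ t ∈ B, s ≠ t → ∃ e ∈ E, (e.1 = s ∨ e.1 = t) ∧ d e.1 e.2 ≤ d s t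

theorem Covers.mono {d : α → α → β} {E E' : List (α × α)} {A A' B B' : List α}
    (h : Covers d E A B) (hE : E ⊆ E') (hA : A' ⊆ A) (hB : B' ⊆ B) : Covers d E' A' B' := by
  intro s hs t ht hst
  obtain ⟨e, he, h'⟩ := h s (hA hs) t (hB ht) hst
  exact ⟨e, hE he, h'⟩

/-- Induction along the path. The pool `last :: restS` consists of the objects not yet left by an
edge. A pair containing `last` is dominated by the next edge, and every other pair passes to the
smaller pool. Requiring `restS.length < fuel` keeps the fuel from cutting the path short. -/
theorem extend_spec [DecidableEq α] (d : α → α → β) (hd : ∀ s t, d s t = d t s) (base N : ℕ) (I : List α)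
    (hIN : I.length ≤ N) : ∀ (fuel : ℕ) (restS restI : List α) (last : α) (E : List (α × α)),
    restS.Nodup → restI.Nodup → (∀ y, y ∈ restI ↔ y ∈ I ∧ y ∈ restS) → last ∉ restS →
    restS.length < fuel → restS.length ≤ N →
    (extend d base I fuel restS restI last E).Spec fun E' c => ∃ q : List α,
      E' = ((last :: q).zip q).reverse ++ E ∧ (last :: q).Nodup ∧ q ⊆ restS ∧
      (∀ s ∈ last :: restS, s ∈ I → ∀ t ∈ last :: restS, s ≠ t →
        ∃ e ∈ (last :: q).zip q, (e.1 = s ∨ e.1 = t) ∧ d e.1 e.2 ≤ d s t) ∧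
      q.length ≤ 2 * restI.length + (if last ∈ I then 1 else 0) ∧
      c.time ≤ (q.length + 1) * (7 * N + 3) ∧
      c.space ≤ base + I.length + 2 * restS.length + E.length + 1 := by
  intro fuel
  induction fuel with
  | zero => intro _ _ _ _ _ _ _ _ h; omega
  | succ fuel ih =>
    intro restS restI last E hS hI hmem hlast hfuel hN
    have hle : restI.length ≤ restS.length :=
      (List.subperm_of_subset hI fun y hy => ((hmem y).1 hy).2).length_le
    refine Prog.spec_live_bind (Prog.spec_charge_bind ?_)
    split
    · rename_i hnil
      refine Prog.spec_pure ⟨[], by simp, by simp, by simp, ?_, by simp, ?_, ?_⟩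
      -- When the path stops, no pair is left to cover: either the pool is just `last`, or `last ∉
      -- I` and the pool contains no object of `I`.
      · intro s hs hsI t ht hst
        exfalso
        by_cases hl : last ∈ I
        · rw [if_pos hl] at hnil
          subst hnil
          simp only [List.mem_cons, List.not_mem_nil, or_false] at hs ht
          exact hst (hs.trans ht.symm)
        · rw [if_neg hl] at hnil
          subst hnil
          rcases List.mem_cons.1 hs with rfl | hs
          · exact hl hsI
          · simpa using (hmem s).2 ⟨hsI, hs⟩
      · simp only [List.length_nil]; omega
      · simp only; omega
    · rename_i z l hzl
      refine (argmin_spec (d last) l z).bind ?_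
      rintro w c ⟨hw, hmin, ht, hs⟩
      rw [← hzl] at hw hmin
      have hlen : l.length + 1 ≤ restS.length := by
        have : (z :: l).length ≤ restS.length := by
          rw [← hzl]; split <;> omega
        simpa using this
      have hwS : w ∈ restS := by
        split at hw
        · exact hw
        · exact ((hmem w).1 hw).2
      have hlS : (restS.erase w).length + 1 = restS.length := by
        rw [List.length_erase_of_mem hwS]
        have := List.length_pos_of_mem hwS
        omega
      have hwI : w ∈ restI ↔ w ∈ I := by rw [hmem]; tauto
      have hlI : (restI.erase w).length + (if w ∈ I then 1 else 0) = restI.length := by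
        split
        · rename_i h
          have h' := hwI.2 h
          rw [List.length_erase_of_mem h']
          have := List.length_pos_of_mem h'
          omega
        · rename_i h
          rw [List.erase_of_not_mem (fun h' => h (hwI.1 h'))]
          simp
      refine Prog.spec_charge_bind ((ih (restS.erase w) (restI.erase w) w ((last, w) :: E)
        (hS.erase _) (hI.erase _) ?_ ?_ (by omega) (by omega)).mono ?_)
      · intro y
        rw [hI.mem_erase_iff, hS.mem_erase_iff, hmem]
        tauto
      · exact fun h => (hS.mem_erase_iff.1 h).1 rfl
      · rintro E' c' ⟨q, rfl, hq, hqS, hcov, hql, hct, hcs⟩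
        have hpool : ∀ y, y ∈ restS → y ∈ w :: restS.erase w := by
          intro y hy
          by_cases hyw : y = w
          · simp [hyw]
          · exact List.mem_cons_of_mem _ (hS.mem_erase_iff.2 ⟨hyw, hy⟩)
        have hsub : w :: q ⊆ restS := by
          intro y hy
          rcases List.mem_cons.1 hy with rfl | hy
          · exact hwS
          · exact List.mem_of_mem_erase (hqS hy)
        refine ⟨w :: q, by simp, ?_, hsub, ?_, ?_, ?_, ?_⟩
        · exact List.nodup_cons.2 ⟨fun h => hlast (hsub h), hq⟩
        · intro s hs hsI t ht hst
          -- If `s` is `last`, then `s ∈ I` and the search ran over all of `restS`, which contains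
          -- `t`. If `t` is `last`, the search ran over `restS` or `restI`, and `s ∈ I` lies in
          -- both. Symmetry of `d` is needed only in this second case.
          rcases List.mem_cons.1 hs with rfl | hsS
          · refine ⟨(s, w), by simp, Or.inl rfl, ?_⟩
            rcases List.mem_cons.1 ht with rfl | ht
            · exact absurd rfl hst
            · exact hmin t (by rw [if_pos hsI]; exact ht)
          · rcases List.mem_cons.1 ht with rfl | ht
            · refine ⟨(t, w), by simp, Or.inr rfl, ?_⟩
              rw [hd s t]
              refine hmin s ?_
              split
              · exact hsS
              · exact (hmem s).2 ⟨hsI, hsS⟩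
            · obtain ⟨e, he, h'⟩ := hcov s (hpool s hsS) hsI t (hpool t ht) hst
              exact ⟨e, by simp [he], h'⟩
        · simp only [List.length_cons]
          -- A step from outside `I` uses up an object of `restI`. The extra unit allows one step
          -- from `last ∈ I` to the outside.
          by_cases hl : last ∈ I
          · rw [if_pos hl]
            split at hql <;> simp_all <;> omega
          · rw [if_neg hl] at hw ⊢
            rw [if_pos (hwI.1 hw)] at hql hlI
            omega
        · simp only [List.length_cons, ht]
          -- One round costs at most `7 * N + 3`: a pass over `I`, four units per candidate, and two
          -- removals, each with an additive constant. For the space bound, `restS` loses the cell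
          -- that `E` gains.
          have : (q.length + 1 + 1) * (7 * N + 3) = (q.length + 1) * (7 * N + 3) + (7 * N + 3) := by
            ring
          omega
        · simp only [List.length_cons, hs] at hcs ⊢
          omega

/-! ### Path unions -/

theorem zip_tail_snd_inj {p : List α} (hp : p.Nodup) {e e' : α × α} (he : e ∈ p.zip p.tail)
    (he' : e' ∈ p.zip p.tail) (h : e.2 = e'.2) : e = e' := by
  have : ((p.zip p.tail).map Prod.snd).Nodup := by
    rw [List.map_snd_zip (by simp)]
    exact hp.tail
  exact List.inj_on_of_nodup_map this he he' h

theorem zip_tail_fst_ne_snd {p : List α} (hp : p.Nodup) {e : α × α} (he : e ∈ p.zip p.tail) :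
    e.1 ≠ e.2 := by
  obtain ⟨i, hi, rfl⟩ := List.mem_iff_getElem.1 he
  simp only [List.getElem_zip, List.getElem_tail]
  intro h
  have := (hp.getElem_inj_iff).1 h
  omega

theorem isPathUnion_zip {v : α} {q : List α} (h : (v :: q).Nodup) :
    IsPathUnion (((v :: q).zip q).reverse) := by
  refine ⟨List.nodup_reverse.2 ?_, v :: q, h, fun e he => by simpa using he⟩
  apply List.Nodup.of_map Prod.snd
  rw [List.map_snd_zip (by simp)]
  exact (List.nodup_cons.1 h).2

theorem IsPathUnion.sublist {E E' : List (α × α)} (h : IsPathUnion E) (hE : E'.Sublist E) :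
    IsPathUnion E' := by
  obtain ⟨h1, p, hp, h2⟩ := h
  exact ⟨h1.sublist hE, p, hp, fun e he => h2 e (hE.subset he)⟩

theorem IsPathUnion.fst_ne_snd {E : List (α × α)} (h : IsPathUnion E) {e : α × α} (he : e ∈ E) :
    e.1 ≠ e.2 := by
  obtain ⟨-, p, hp, h2⟩ := h
  exact zip_tail_fst_ne_snd hp (h2 e he)

theorem length_le_one_of_nodup_of_forall_eq {γ : Type u} {l : List γ} (h : l.Nodup)
    (heq : ∀ a ∈ l, ∀ b ∈ l, a = b) : l.length ≤ 1 := by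
  match l with
  | [] => simp
  | [_] => simp
  | a :: b :: l =>
    have hab := heq a (by simp) b (by simp)
    simp [hab] at h

/-- In-degree at most one: on a path without repetitions an edge is determined by its target. -/
theorem IsPathUnion.length_filter_snd_le [DecidableEq α] {E : List (α × α)} (h : IsPathUnion E) (x : α) :
    (E.filter (fun e => decide (e.2 = x))).length ≤ 1 := by
  obtain ⟨h1, p, hp, h2⟩ := h
  refine length_le_one_of_nodup_of_forall_eq (h1.filter _) ?_
  intro a ha b hb
  simp only [List.mem_filter, decide_eq_true_eq] at ha hb
  exact zip_tail_snd_inj hp (h2 a ha.1) (h2 b hb.1) (ha.2.trans hb.2.symm)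

end

/-! ### Objects and edges of a list of parts -/

section

variable {α : Type u} {β : Type v} [LinearOrder β]

theorem allPts_cons (p : Part α) (ps : List (Part α)) : allPts (p :: ps) = p.pts ++ allPts ps := by
  simp [allPts]

theorem allEdges_cons (p : Part α) (ps : List (Part α)) :
    allEdges (p :: ps) = p.edges ++ allEdges ps := by
  simp [allEdges]

theorem mem_allPts {ps : List (Part α)} {y : α} : y ∈ allPts ps ↔ ∃ p ∈ ps, y ∈ p.pts := by
  simp [allPts]

theorem mem_allEdges {ps : List (Part α)} {e : α × α} :
    e ∈ allEdges ps ↔ ∃ p ∈ ps, e ∈ p.edges := by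
  simp [allEdges]

/-! ### The invariant of the list of parts -/

/-- The parts `ps`, newest first, together with the list `R` of unassigned objects, partition `S`;
their digraphs are path unions, and the digraph of each part covers all pairs formed by an object
of the part and another object of the same or of an older part. -/
structure Inv (d : α → α → β) (S R : List α) (ps : List (Part α)) : Prop where
  nodup : S.Nodup
  perm : (R ++ allPts ps).Perm S
  ne_nil : ∀ p ∈ ps, p.pts ≠ []
  path : ∀ p ∈ ps, IsPathUnion p.edges
  mem : ∀ p ∈ ps, ∀ e ∈ p.edges, e.1 ∈ S ∧ e.2 ∈ S
  covers_self : ∀ p ∈ ps, Covers d p.edges p.pts p.pts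
  covers_later : ps.Pairwise fun p q => Covers d p.edges p.pts q.pts

theorem Inv.single {d : α → α → β} {S : List α} (hS : S.Nodup) : Inv d S S [] where
  nodup := hS
  perm := by simp [allPts]
  ne_nil := by simp
  path := by simp
  mem := by simp
  covers_self := by simp
  covers_later := by simp

theorem length_le_length_allPts {ps : List (Part α)} (h : ∀ p ∈ ps, p.pts ≠ []) :
    ps.length ≤ (allPts ps).length := by
  induction ps with
  | nil => simp
  | cons p ps ih =>
    have h1 := List.length_pos_of_ne_nil (h p (by simp))
    have h2 := ih fun q hq => h q (by simp [hq])
    simp only [allPts_cons, List.length_append, List.length_cons]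
    omega

theorem Inv.length_eq {d : α → α → β} {S R : List α} {ps : List (Part α)} (h : Inv d S R ps) :
    R.length + (allPts ps).length = S.length := by
  simpa using h.perm.length_eq

theorem Inv.length_parts_le {d : α → α → β} {S R : List α} {ps : List (Part α)}
    (h : Inv d S R ps) : ps.length ≤ S.length := by
  have := length_le_length_allPts h.ne_nil
  have := h.length_eq
  omega

/-- The path is searched for in all of `S`, so the new part covers every older one and may stand at
the head of the list. Of the two edge bounds, the one by `2 * I.length` serves the amortization,
while the one by `S.length` shows that a single part containing everything has no excess edges. -/
theorem addPart_spec [DecidableEq α] {d : α → α → β} (hd : ∀ s t, d s t = d t s) {S I : List α}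
    {ps : List (Part α)} (h : Inv d S I ps) :
    (addPart d S I ps).Spec fun ps' c => Inv d S [] ps' ∧
      ((I = [] ∧ ps' = ps) ∨ (I ≠ [] ∧ ∃ E, ps' = ⟨I, E⟩ :: ps ∧ E.length + 1 ≤ 2 * I.length ∧
        E.length + 1 ≤ S.length)) ∧
      c.time ≤ 22 * (S.length * I.length) + 1 ∧ c.space ≤ partsCells ps + 4 * S.length := by
  unfold addPart
  have hlen := h.length_eq
  split
  · rename_i hI
    refine Prog.spec_charge_bind (Prog.spec_pure ⟨?_, Or.inl ⟨hI, rfl⟩, ?_, ?_⟩)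
    · rw [hI] at h; exact h
    · simp
    · simp
  · rename_i hI
    obtain ⟨v₀, hv₀⟩ := List.exists_mem_of_ne_nil I hI
    refine Prog.spec_choose_bind ⟨v₀, hv₀⟩ ?_
    intro v hv
    have hv : v ∈ I := hv
    have hIS : I ⊆ S := fun y hy => h.perm.subset (List.mem_append_left _ hy)
    have hInd : I.Nodup := (List.nodup_append.1 (h.perm.nodup_iff.2 h.nodup)).1
    have hvS := hIS hv
    have hSl := List.length_pos_of_mem hvS
    have hIl := List.length_pos_of_mem hv
    have heS := List.length_erase_of_mem hvS
    have heI := List.length_erase_of_mem hv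
    refine Prog.spec_charge_bind ((extend_spec d hd _ S.length I (by omega) S.length (S.erase v)
      (I.erase v) v [] (h.nodup.erase _) (hInd.erase _) ?_ ?_ (by omega) (by omega)).bind ?_)
    · intro y
      rw [hInd.mem_erase_iff, h.nodup.mem_erase_iff]
      have := @hIS y
      tauto
    · exact fun h' => (h.nodup.mem_erase_iff.1 h').1 rfl
    · rintro E c ⟨q, rfl, hq, hqS, hcov, hql, hct, hcs⟩
      rw [if_pos hv] at hql
      have hqle : q.length ≤ (S.erase v).length :=
        (List.subperm_of_subset (List.nodup_cons.1 hq).2 hqS).length_le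
      have hpool : ∀ y ∈ S, y ∈ v :: S.erase v := by
        intro y hy
        by_cases hyv : y = v
        · simp [hyv]
        · exact List.mem_cons_of_mem _ (h.nodup.mem_erase_iff.2 ⟨hyv, hy⟩)
      have hcovS : Covers d (((v :: q).zip q).reverse ++ []) I S := by
        intro s hs t ht hst
        obtain ⟨e, he, h'⟩ := hcov s (hpool s (hIS hs)) hs t (hpool t ht) hst
        exact ⟨e, by simpa using he, h'⟩
      have hEl : (((v :: q).zip q).reverse ++ []).length = q.length := by simp
      have hsub : v :: q ⊆ S := by
        intro y hy
        rcases List.mem_cons.1 hy with rfl | hy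
        · exact hvS
        · exact List.mem_of_mem_erase (hqS hy)
      refine Prog.spec_pure ⟨?_, Or.inr ⟨hI, _, rfl, by omega, by omega⟩, ?_, ?_⟩
      · refine ⟨h.nodup, ?_, ?_, ?_, ?_, ?_, ?_⟩
        · rw [allPts_cons]; exact h.perm
        · simpa [hI] using h.ne_nil
        · intro p hp
          rcases List.mem_cons.1 hp with rfl | hp
          · simpa using isPathUnion_zip hq
          · exact h.path p hp
        · intro p hp e he
          rcases List.mem_cons.1 hp with rfl | hp
          · have he : (e.1, e.2) ∈ (v :: q).zip q := by simpa using he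
            have := List.of_mem_zip he
            exact ⟨hsub this.1, hsub (List.mem_cons_of_mem _ this.2)⟩
          · exact h.mem p hp e he
        · intro p hp
          rcases List.mem_cons.1 hp with rfl | hp
          · exact hcovS.mono (List.Subset.refl _) (List.Subset.refl _) hIS
          · exact h.covers_self p hp
        · refine List.pairwise_cons.2 ⟨fun p hp => ?_, h.covers_later⟩
          refine hcovS.mono (List.Subset.refl _) (List.Subset.refl _) fun y hy => ?_
          exact h.perm.subset (List.mem_append_right _ (mem_allPts.2 ⟨p, hp, hy⟩))
      -- The constant 22 is `14 + 6` from the rounds and `1 + 1` from the initial removals of `v`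
      -- from `S` and `I`.
      · have h1 : (q.length + 1) * (7 * S.length + 3) ≤ (2 * I.length) * (7 * S.length + 3) :=
          Nat.mul_le_mul_right _ (by omega)
        have h2 : S.length ≤ S.length * I.length := Nat.le_mul_of_pos_right _ hIl
        have h3 : I.length ≤ S.length * I.length := Nat.le_mul_of_pos_left _ hSl
        have h4 : (2 * I.length) * (7 * S.length + 3) =
          14 * (S.length * I.length) + 6 * I.length := by ring
        simp only
        omega
      · simp only [List.length_nil] at hcs ⊢
        omega

/-! ### The answer is found among the edges -/

/-- `Inv` covers a pair only from its newer part. The relation `R` forgets which part supplied the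
edge; it is symmetric because `d` is, so pairwise domination along the list extends to all pairs of
parts. -/
theorem Inv.exists_edge_le {d : α → α → β} (hd : ∀ s t, d s t = d t s) {S : List α}
    {ps : List (Part α)} (h : Inv d S [] ps) {x y : α} (hx : x ∈ S) (hy : y ∈ S) (hxy : x ≠ y) :
    ∃ e ∈ allEdges ps, d e.1 e.2 ≤ d x y := by
  have hmem : ∀ z ∈ S, ∃ p ∈ ps, z ∈ p.pts := fun z hz =>
    mem_allPts.1 (by simpa using h.perm.symm.subset hz)
  obtain ⟨p, hp, hxp⟩ := hmem x hx
  obtain ⟨q, hq, hyq⟩ := hmem y hy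
  let R : Part α → Part α → Prop := fun p q => ∀ s ∈ p.pts, ∀ t ∈ q.pts, s ≠ t →
    ∃ e ∈ allEdges ps, d e.1 e.2 ≤ d s t
  have hR : ∀ p ∈ ps, ∀ q, Covers d p.edges p.pts q.pts → R p q := by
    intro p hp q hc s hs t ht hst
    obtain ⟨e, he, -, hle⟩ := hc s hs t ht hst
    exact ⟨e, mem_allEdges.2 ⟨p, hp, he⟩, hle⟩
  have hsymm : ∀ p q, R p q → R q p := by
    intro p q h' s hs t ht hst
    obtain ⟨e, he, hle⟩ := h' t ht s hs hst.symm
    exact ⟨e, he, hd s t ▸ hle⟩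
  have hpw : ps.Pairwise R := h.covers_later.imp_of_mem fun hp _ hc => hR _ hp _ hc
  have : Std.Symm R := ⟨hsymm⟩
  exact List.Pairwise.forall_of_forall (fun p hp => hR p hp p (h.covers_self p hp)) hpw
    hp hq x hxp y hyq hxy

theorem scan_spec [DecidableEq α] {d : α → α → β} (hd : ∀ s t, d s t = d t s) {S : List α}
    {ps : List (Part α)} (h : Inv d S [] ps) :
    (scan d S ps).Spec fun σ c => σ.objs = S ∧ σ.parts = ps ∧
      IsClosestPair d S.toFinset σ.best ∧
      c.time ≤ ps.length + 4 * (allEdges ps).length + 2 ∧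
      c.space = S.length + partsCells ps + 1 := by
  refine Prog.spec_charge_bind (Prog.spec_live_bind ?_)
  split
  · rename_i hnil
    refine Prog.spec_pure ⟨rfl, rfl, ?_, by simp only; omega, by simp⟩
    refine Finset.card_le_one.2 fun x hx y hy => ?_
    by_contra hxy
    obtain ⟨e, he, -⟩ := h.exists_edge_le hd (List.mem_toFinset.1 hx) (List.mem_toFinset.1 hy) hxy
    simp [hnil] at he
  · rename_i e l hel
    refine (argmin_spec (fun e : α × α => d e.1 e.2) l e).bind ?_
    rintro e' c ⟨he', hmin, ht, hs⟩
    rw [← hel] at he' hmin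
    refine Prog.spec_pure ⟨rfl, rfl, ?_, ?_, ?_⟩
    · obtain ⟨p, hp, hep⟩ := mem_allEdges.1 he'
      have hm := h.mem p hp e' hep
      refine ⟨by simpa using hm.1, by simpa using hm.2, (h.path p hp).fst_ne_snd hep, ?_⟩
      intro x hx y hy hxy
      obtain ⟨f, hf, hle⟩ :=
        h.exists_edge_le hd (List.mem_toFinset.1 hx) (List.mem_toFinset.1 hy) hxy
      exact (hmin f hf).trans hle
    · simp only [ht, hel, List.length_cons]; omega
    · simp [hs]

/-! ### Splitting off two parts of similar size -/

theorem IsSplit.symm {ps rest : List (Part α)} {A B : Part α} (h : IsSplit ps A B rest) :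
    IsSplit ps B A rest :=
  ⟨h.1.trans (List.Perm.swap _ _ _), h.2⟩

theorem IsSplit.mem_left {ps rest : List (Part α)} {A B : Part α} (h : IsSplit ps A B rest) :
    A ∈ ps :=
  h.1.symm.subset (by simp)

theorem IsSplit.mem_right {ps rest : List (Part α)} {A B : Part α} (h : IsSplit ps A B rest) :
    B ∈ ps :=
  h.symm.mem_left

/-- The ratio does not depend on the remaining parts, so it is minimized over the finite set of
pairs `(A, B)`. -/
theorem exists_isBestSplit {ps : List (Part α)} (h : 2 ≤ ps.length) :
    ∃ r : Part α × Part α × List (Part α), IsBestSplit ps r.1 r.2.1 r.2.2 := by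
  let T : Set (Part α × Part α) :=
    {r | (∃ rest, IsSplit ps r.1 r.2 rest) ∧ r.1.pts.length ≤ r.2.pts.length}
  have hfin : T.Finite := by
    refine ((List.finite_toSet ps).prod (List.finite_toSet ps)).subset ?_
    rintro r ⟨⟨rest, hr⟩, -⟩
    exact ⟨hr.mem_left, hr.mem_right⟩
  have hne : T.Nonempty := by
    obtain ⟨A, B, rest, rfl⟩ : ∃ A B rest, ps = A :: B :: rest := by
      match ps, h with
      | A :: B :: rest, _ => exact ⟨A, B, rest, rfl⟩
    have hs : IsSplit (A :: B :: rest) A B rest :=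
      ⟨List.Perm.refl _, (List.sublist_cons_self B rest).trans (List.sublist_cons_self A _)⟩
    rcases le_total A.pts.length B.pts.length with hAB | hAB
    · exact ⟨(A, B), ⟨rest, hs⟩, hAB⟩
    · exact ⟨(B, A), ⟨rest, hs.symm⟩, hAB⟩
  obtain ⟨r, ⟨⟨rest, hr⟩, hle⟩, hmin⟩ := Set.exists_min_image T
    (fun r => (r.2.pts.length : ℚ) / r.1.pts.length) hfin hne
  exact ⟨(r.1, r.2, rest), hr, hle, fun A' B' rest' hs' hle' => hmin (A', B') ⟨⟨rest', hs'⟩, hle'⟩⟩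

/-- The form in which pigeonhole is used: two different entries of the list, with the others left in
their order. That order records the ages of the parts. -/
theorem exists_isSplit_of_not_nodup {γ : Type*} (f : Part α → γ) {ps : List (Part α)}
    (h : ¬ (ps.map f).Nodup) : ∃ A B rest, IsSplit ps A B rest ∧ f A = f B := by
  induction ps with
  | nil => simp at h
  | cons p ps ih =>
    rw [List.map_cons, List.nodup_cons, not_and_or, not_not] at h
    rcases h with h | h
    · obtain ⟨q, hq, hqp⟩ := List.mem_map.1 h
      obtain ⟨s, t, rfl⟩ := List.append_of_mem hq
      refine ⟨p, q, s ++ t, ⟨?_, ?_⟩, hqp.symm⟩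
      · exact List.Perm.cons _ List.perm_middle
      · exact (List.Sublist.append_left (List.sublist_cons_self q t) s).cons p
    · obtain ⟨A, B, rest, hs, hf⟩ := ih h
      refine ⟨A, B, p :: rest, ⟨?_, hs.2.cons_cons p⟩, hf⟩
      refine (hs.1.cons p).trans ?_
      exact (List.Perm.swap A p _).trans ((List.Perm.swap B p _).cons A)

theorem length_pts_le_of_mem {ps : List (Part α)} {p : Part α} (hp : p ∈ ps) :
    p.pts.length ≤ (allPts ps).length := by
  obtain ⟨s, t, rfl⟩ := List.append_of_mem hp
  simp only [allPts, List.flatMap_append, List.flatMap_cons, List.length_append]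
  omega

/-- Two parts with the same `⌊log₄⌋` of their sizes differ by a factor below 4, and the best pair is
no worse. -/
theorem IsBestSplit.le_four_mul {ps rest : List (Part α)} {A B : Part α} {n : ℕ}
    (h : IsBestSplit ps A B rest) (hne : ∀ p ∈ ps, p.pts ≠ []) (hn : (allPts ps).length ≤ n)
    (hk : Nat.log 2 n < ps.length) (hk' : 2 ≤ ps.length) :
    B.pts.length ≤ 4 * A.pts.length := by
  have hpos : ∀ p ∈ ps, 0 < p.pts.length := fun p hp => List.length_pos_of_ne_nil (hne p hp)
  have hdup : ¬ (ps.map fun p => Nat.log 4 p.pts.length).Nodup := by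
    intro hnd
    have hsub : ps.map (fun p => Nat.log 4 p.pts.length) ⊆ List.range (Nat.log 4 n + 1) := by
      intro j hj
      obtain ⟨p, hp, rfl⟩ := List.mem_map.1 hj
      have := Nat.log_mono_right (b := 4) ((length_pts_le_of_mem hp).trans hn)
      simp only [List.mem_range]
      omega
    have hlen := (List.subperm_of_subset hnd hsub).length_le
    simp only [List.length_map, List.length_range] at hlen
    have hn0 : n ≠ 0 := by
      have := length_le_length_allPts hne
      omega
    have h1 : 4 ^ Nat.log 4 n ≤ n := Nat.pow_log_le_self 4 hn0
    have h2 : n < 2 ^ (Nat.log 4 n + 1) :=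
      Nat.lt_pow_of_log_lt (by norm_num) (by omega)
    -- If the values were distinct, then `log₂ n < k ≤ log₄ n + 1` for the number `k` of parts.
    -- Since `4 ^ log₄ n ≤ n`, this forces `log₄ n = 0` and `k ≤ 1`, contrary to `hk'`.
    have h3 : 2 ^ (2 * Nat.log 4 n) < 2 ^ (Nat.log 4 n + 1) := by
      rw [pow_mul]; norm_num; omega
    have h4 := (Nat.pow_lt_pow_iff_right (by norm_num : 1 < 2)).1 h3
    omega
  have key : ∃ A' B' rest', IsSplit ps A' B' rest' ∧ A'.pts.length ≤ B'.pts.length ∧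
      B'.pts.length ≤ 4 * A'.pts.length := by
    have hlog : ∀ P Q : Part α, P ∈ ps → Nat.log 4 P.pts.length = Nat.log 4 Q.pts.length →
        Q.pts.length ≤ 4 * P.pts.length := by
      intro P Q hP hPQ
      have h1 : 4 ^ Nat.log 4 P.pts.length ≤ P.pts.length :=
        Nat.pow_log_le_self 4 (hpos P hP).ne'
      have h2 := Nat.lt_pow_succ_log_self (b := 4) (by norm_num) Q.pts.length
      rw [← hPQ, Nat.pow_succ] at h2
      omega
    obtain ⟨A', B', rest', hs, hf⟩ := exists_isSplit_of_not_nodup _ hdup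
    rcases le_total A'.pts.length B'.pts.length with hle | hle
    · exact ⟨A', B', rest', hs, hle, hlog A' B' hs.mem_left hf⟩
    · exact ⟨B', A', rest', hs.symm, hle, hlog B' A' hs.mem_right hf.symm⟩
  obtain ⟨A', B', rest', hs, hle, hle4⟩ := key
  have hq := h.2.2 A' B' rest' hs hle
  have hA : (0 : ℚ) < A.pts.length := by exact_mod_cast hpos A h.1.mem_left
  have hA' : (0 : ℚ) < A'.pts.length := by exact_mod_cast hpos A' hs.mem_left
  have h4 : (B'.pts.length : ℚ) / A'.pts.length ≤ 4 := by
    rw [div_le_iff₀ hA']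
    exact_mod_cast hle4
  have := (div_le_iff₀ hA).1 (hq.trans h4)
  exact_mod_cast this

/-- The objects of the two chosen parts become unassigned. Because `rest` is a sublist, not merely a
permutation of what remains, `covers_later` survives. -/
theorem Inv.split {d : α → α → β} {S : List α} {ps rest : List (Part α)} {A B : Part α}
    (h : Inv d S [] ps) (hs : IsSplit ps A B rest) : Inv d S (A.pts ++ B.pts) rest := by
  have hsub : rest ⊆ ps := hs.2.subset
  refine ⟨h.nodup, ?_, fun p hp => h.ne_nil p (hsub hp), fun p hp => h.path p (hsub hp),
    fun p hp => h.mem p (hsub hp), fun p hp => h.covers_self p (hsub hp),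
    h.covers_later.sublist hs.2⟩
  have h1 : (allPts ps).Perm (allPts (A :: B :: rest)) := hs.1.flatMap_right _
  rw [allPts_cons, allPts_cons, ← List.append_assoc] at h1
  exact h1.symm.trans (by simpa using h.perm)

/-! ### Detaching an object and its predecessors -/

section Detach

variable [DecidableEq α]

theorem allPts_detach (x : α) (Y : List α) (ps : List (Part α)) :
    allPts (detach x Y ps) = (allPts ps).filter (fun y => decide (y ≠ x ∧ y ∉ Y)) := by
  induction ps with
  | nil => simp [detach, allPts]
  | cons p ps ih =>
    rw [allPts_cons, List.filter_append, ← ih]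
    simp only [detach, List.map_cons, List.filter_cons]
    split
    · rw [allPts_cons]
    · rename_i h
      have : p.pts.filter (fun y => decide (y ≠ x ∧ y ∉ Y)) = [] := by
        simpa only [Bool.not_eq_true', Bool.not_eq_false, List.isEmpty_iff] using h
      rw [this, List.nil_append]

theorem mem_preds {x y : α} {ps : List (Part α)} :
    y ∈ preds x ps ↔ ∃ p ∈ ps, (y, x) ∈ p.edges := by
  simp only [preds, List.mem_map, List.mem_filter, decide_eq_true_eq, mem_allEdges]
  constructor
  · rintro ⟨⟨a, b⟩, ⟨⟨p, hp, he⟩, rfl⟩, rfl⟩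
    exact ⟨p, hp, he⟩
  · rintro ⟨p, hp, he⟩
    exact ⟨(y, x), ⟨⟨p, hp, he⟩, rfl⟩, rfl⟩

/-- Each digraph contributes at most one predecessor of `x`. -/
theorem length_preds_le {x : α} {ps : List (Part α)} (h : ∀ p ∈ ps, IsPathUnion p.edges) :
    (preds x ps).length ≤ ps.length := by
  induction ps with
  | nil => simp [preds, allEdges]
  | cons p ps ih =>
    have h1 := (h p (by simp)).length_filter_snd_le x
    have h2 := ih fun q hq => h q (by simp [hq])
    simp only [preds, allEdges_cons, List.filter_append, List.map_append, List.length_append,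
      List.length_map, List.length_cons] at h2 ⊢
    omega

/-- The pairs that might lose their dominating edge are exactly those handed over to the unassigned
list `(preds x ps).dedup`, so what stays in the parts is still covered. -/
theorem Inv.detach {d : α → α → β} {S : List α} {ps : List (Part α)} (h : Inv d S [] ps) (x : α) :
    Inv d (S.erase x) (preds x ps).dedup (CongaLine.detach x (preds x ps) ps) := by
  have hpm : (allPts ps).Perm S := by simpa using h.perm
  have hpre : ∀ p ∈ CongaLine.detach x (preds x ps) ps, ∃ p₀ ∈ ps,
      p.pts = p₀.pts.filter (fun y => decide (y ≠ x ∧ y ∉ preds x ps)) ∧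
      p.edges = p₀.edges.filter (fun e => decide (e.1 ≠ x ∧ e.2 ≠ x)) := by
    intro p hp
    obtain ⟨p₀, hp₀, rfl⟩ := List.mem_map.1 (List.mem_filter.1 hp).1
    exact ⟨p₀, hp₀, rfl, rfl⟩
  have hcov : ∀ p ∈ ps, ∀ A B, Covers d p.edges A B →
      Covers d (p.edges.filter (fun e => decide (e.1 ≠ x ∧ e.2 ≠ x)))
        (A.filter (fun y => decide (y ≠ x ∧ y ∉ preds x ps)))
        (B.filter (fun y => decide (y ≠ x ∧ y ∉ preds x ps))) := by
    intro p hp A B hc s hs t ht hst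
    simp only [List.mem_filter, decide_eq_true_eq] at hs ht
    obtain ⟨e, he, hst', hle⟩ := hc s hs.1 t ht.1 hst
    have he1 : e.1 ≠ x ∧ e.1 ∉ preds x ps := by
      rcases hst' with h' | h' <;> rw [h']
      · exact hs.2
      · exact ht.2
    -- The dominating edge survives: its source is an end of the pair, hence not `x`; and if its
    -- target were `x`, the source would be a predecessor and would have been filtered out.
    refine ⟨e, List.mem_filter.2 ⟨he, decide_eq_true ⟨he1.1, fun h2 => he1.2 ?_⟩⟩, hst', hle⟩
    exact mem_preds.2 ⟨p, hp, by rw [← h2]; exact he⟩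
  refine ⟨h.nodup.erase _, ?_, ?_, ?_, ?_, ?_, ?_⟩
  · rw [allPts_detach, List.perm_ext_iff_of_nodup]
    · intro y
      simp only [List.mem_append, List.mem_dedup, List.mem_filter, decide_eq_true_eq,
        h.nodup.mem_erase_iff, hpm.mem_iff]
      have : y ∈ preds x ps → y ∈ S ∧ y ≠ x := by
        intro hy
        obtain ⟨p, hp, he⟩ := mem_preds.1 hy
        exact ⟨(h.mem p hp _ he).1, (h.path p hp).fst_ne_snd he⟩
      tauto
    · refine List.nodup_append.2 ⟨List.nodup_dedup _, (hpm.nodup_iff.2 h.nodup).filter _, ?_⟩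
      intro a ha b hb hab
      subst hab
      simp only [List.mem_filter, decide_eq_true_eq] at hb
      exact hb.2.2 (List.mem_dedup.1 ha)
    · exact h.nodup.erase _
  · intro p hp
    have := (List.mem_filter.1 hp).2
    simpa [List.isEmpty_iff] using this
  · intro p hp
    obtain ⟨p₀, hp₀, -, he⟩ := hpre p hp
    rw [he]
    exact (h.path p₀ hp₀).sublist List.filter_sublist
  · intro p hp e he
    obtain ⟨p₀, hp₀, -, he₀⟩ := hpre p hp
    rw [he₀, List.mem_filter, decide_eq_true_eq] at he
    have := h.mem p₀ hp₀ e he.1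
    exact ⟨h.nodup.mem_erase_iff.2 ⟨he.2.1, this.1⟩, h.nodup.mem_erase_iff.2 ⟨he.2.2, this.2⟩⟩
  · intro p hp
    obtain ⟨p₀, hp₀, h1, h2⟩ := hpre p hp
    rw [h1, h2]
    exact hcov p₀ hp₀ _ _ (h.covers_self p₀ hp₀)
  · refine List.Pairwise.filter _ (List.pairwise_map.2 ?_)
    exact h.covers_later.imp_of_mem fun hp _ hc => hcov _ hp _ _ hc

theorem length_allEdges_detach_le (x : α) (Y : List α) (ps : List (Part α)) :
    (allEdges (detach x Y ps)).length ≤ (allEdges ps).length := by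
  induction ps with
  | nil => simp [detach, allEdges]
  | cons p ps ih =>
    have hf := List.length_filter_le (fun e : α × α => decide (e.1 ≠ x ∧ e.2 ≠ x)) p.edges
    simp only [detach, List.map_cons, List.filter_cons] at ih ⊢
    split
    · rw [allEdges_cons, allEdges_cons, List.length_append, List.length_append]
      simp only
      omega
    · rw [allEdges_cons, List.length_append]
      omega

theorem length_detach_le (x : α) (Y : List α) (ps : List (Part α)) :
    (detach x Y ps).length ≤ ps.length := by
  unfold detach
  exact (List.length_filter_le _ _).trans (by simp)

end Detach

end

/-! ### The function `s log₂ s` -/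

/-- `s log₂ s`. -/
noncomputable def xlog (s : ℕ) : ℝ := s * Real.logb 2 s

theorem logb_two_natCast_nonneg (n : ℕ) : 0 ≤ Real.logb 2 n := by
  rcases Nat.eq_zero_or_pos n with rfl | hn
  · simp
  · exact Real.logb_nonneg (by norm_num) (by exact_mod_cast hn)

theorem logb_two_natCast_mono {a b : ℕ} (h : a ≤ b) : Real.logb 2 a ≤ Real.logb 2 b := by
  rcases Nat.eq_zero_or_pos a with rfl | ha
  · simpa using logb_two_natCast_nonneg b
  · exact Real.logb_le_logb_of_le (by norm_num) (by exact_mod_cast ha) (by exact_mod_cast h)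

theorem xlog_nonneg (s : ℕ) : 0 ≤ xlog s :=
  mul_nonneg (Nat.cast_nonneg s) (logb_two_natCast_nonneg s)

theorem xlog_mono {a b : ℕ} (h : a ≤ b) : xlog a ≤ xlog b :=
  mul_le_mul (by exact_mod_cast h) (logb_two_natCast_mono h) (logb_two_natCast_nonneg a)
    (Nat.cast_nonneg b)

theorem xlog_add_le (a b : ℕ) : xlog a + xlog b ≤ xlog (a + b) := by
  have h1 : (a : ℝ) * Real.logb 2 a ≤ a * Real.logb 2 (a + b : ℕ) :=
    mul_le_mul_of_nonneg_left (logb_two_natCast_mono (by omega)) (Nat.cast_nonneg a)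
  have h2 : (b : ℝ) * Real.logb 2 b ≤ b * Real.logb 2 (a + b : ℕ) :=
    mul_le_mul_of_nonneg_left (logb_two_natCast_mono (by omega)) (Nat.cast_nonneg b)
  have h3 : xlog (a + b) = a * Real.logb 2 (a + b : ℕ) + b * Real.logb 2 (a + b : ℕ) := by
    rw [xlog]; push_cast; ring
  rw [h3]
  exact add_le_add h1 h2

/-- Each of the `a` elements of the smaller set moves to a set at least twice as large, so its
logarithm grows by at least 1. -/
theorem xlog_add_add_le {a b : ℕ} (ha : 0 < a) (hab : a ≤ b) :
    xlog a + xlog b + a ≤ xlog (a + b) := by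
  have ha' : (0 : ℝ) < a := by exact_mod_cast ha
  have hlog : Real.logb 2 a + 1 ≤ Real.logb 2 (a + b : ℕ) := by
    have : Real.logb 2 a + 1 = Real.logb 2 (2 * a : ℕ) := by
      push_cast
      rw [Real.logb_mul (by norm_num) ha'.ne', Real.logb_self_eq_one (by norm_num)]
      ring
    rw [this]
    exact logb_two_natCast_mono (by omega)
  have h1 : (a : ℝ) * (Real.logb 2 a + 1) ≤ a * Real.logb 2 (a + b : ℕ) :=
    mul_le_mul_of_nonneg_left hlog ha'.le
  have h2 : (b : ℝ) * Real.logb 2 b ≤ b * Real.logb 2 (a + b : ℕ) :=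
    mul_le_mul_of_nonneg_left (logb_two_natCast_mono (by omega)) (Nat.cast_nonneg b)
  have h3 : xlog (a + b) = a * Real.logb 2 (a + b : ℕ) + b * Real.logb 2 (a + b : ℕ) := by
    rw [xlog]; push_cast; ring
  rw [h3, xlog, xlog]
  linarith

/-- Write the difference as `(a - b) log₂ a + b log₂ (a / b)`. By `log t ≤ t - 1` and `log 2 > 1 /
2`, the second term is at most `2 (a - b)`. -/
theorem xlog_sub_le {a b n : ℕ} (hba : b ≤ a) (han : a ≤ n) :
    xlog a - xlog b ≤ ((a : ℝ) - b) * (Real.logb 2 n + 2) := by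
  have hba' : (0 : ℝ) ≤ (a : ℝ) - b := sub_nonneg.2 (by exact_mod_cast hba)
  have hlog := logb_two_natCast_mono han
  have h1 : ((a : ℝ) - b) * Real.logb 2 a ≤ ((a : ℝ) - b) * Real.logb 2 n :=
    mul_le_mul_of_nonneg_left hlog hba'
  have h2 : (b : ℝ) * (Real.logb 2 a - Real.logb 2 b) ≤ 2 * ((a : ℝ) - b) := by
    rcases Nat.eq_zero_or_pos b with rfl | hb
    · simp
    have hb' : (0 : ℝ) < b := by exact_mod_cast hb
    have ha' : (0 : ℝ) < a := by linarith
    have hl2 : (1 / 2 : ℝ) < Real.log 2 := by linarith [Real.log_two_gt_d9]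
    have h3 : Real.log (a / b) ≤ a / b - 1 := Real.log_le_sub_one_of_pos (by positivity)
    have h4 : (0 : ℝ) ≤ a / b - 1 := by
      rw [sub_nonneg, le_div_iff₀ hb']; linarith
    have h5 : Real.logb 2 a - Real.logb 2 b ≤ 2 * (a / b - 1) := by
      rw [← Real.logb_div ha'.ne' hb'.ne', Real.logb, div_le_iff₀ (by linarith)]
      nlinarith
    calc (b : ℝ) * (Real.logb 2 a - Real.logb 2 b) ≤ b * (2 * (a / b - 1)) :=
          mul_le_mul_of_nonneg_left h5 hb'.le
      _ = 2 * ((a : ℝ) - b) := by field_simp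
  rw [xlog, xlog]
  linarith

/-! ### The square of the number of parts -/

theorem add_two_sq_le (j : ℕ) : (j + 2) ^ 2 ≤ 5 * 2 ^ j := by
  induction j with
  | zero => norm_num
  | succ j ih =>
    -- `(j + 3)² ≤ 2 (j + 2)²` fails at `j = 0`, so that step is computed directly.
    rcases Nat.eq_zero_or_pos j with rfl | hj
    · norm_num
    · rw [pow_succ 2 j]
      nlinarith

/-- Makes testing all pairs of parts linear in `n`, so that the search is absorbed by the cost of
building the merged path. -/
theorem sq_le_of_le_log_add_two {k n : ℕ} (hn : 0 < n) (hk : k ≤ Nat.log 2 n + 2) :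
    k ^ 2 ≤ 5 * n := by
  have h1 : k ^ 2 ≤ (Nat.log 2 n + 2) ^ 2 := Nat.pow_le_pow_left hk 2
  have h2 := add_two_sq_le (Nat.log 2 n)
  have h3 := Nat.pow_log_le_self 2 hn.ne'
  omega

section

variable {α : Type u} {β : Type v} [LinearOrder β]

/-! ### Potential of a list of parts -/

/-- The sum of `|S_i| log₂ |S_i|` over the parts. -/
noncomputable def weight (ps : List (Part α)) : ℝ := (ps.map fun p => xlog p.pts.length).sum

theorem weight_cons (p : Part α) (ps : List (Part α)) :
    weight (p :: ps) = xlog p.pts.length + weight ps := by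
  simp [weight]

theorem weight_nonneg (ps : List (Part α)) : 0 ≤ weight ps :=
  List.sum_nonneg fun x hx => by
    obtain ⟨p, -, rfl⟩ := List.mem_map.1 hx
    exact xlog_nonneg _

theorem weight_perm {ps qs : List (Part α)} (h : ps.Perm qs) : weight ps = weight qs :=
  (h.map _).sum_eq

theorem weight_le (ps : List (Part α)) : weight ps ≤ xlog (allPts ps).length := by
  induction ps with
  | nil => simp [weight, allPts, xlog]
  | cons p ps ih =>
    rw [weight_cons, allPts_cons, List.length_append]
    exact (add_le_add_right ih _).trans (xlog_add_le _ _)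

theorem Inv.weight_le {d : α → α → β} {S R : List α} {ps : List (Part α)} (h : Inv d S R ps) :
    weight ps ≤ xlog S.length :=
  (CongaLine.weight_le ps).trans (xlog_mono (by have := h.length_eq; omega))

/-- `xlog_sub_le` summed over the parts: each detached object costs at most `log₂ n + 2`. A part
that is dropped has become empty and contributes zero anyway. -/
theorem weight_le_weight_detach [DecidableEq α] (x : α) (Y : List α) {n : ℕ}
    {ps : List (Part α)} (hn : (allPts ps).length ≤ n) :
    weight ps ≤ weight (detach x Y ps) +
      (((allPts ps).length : ℝ) - (allPts (detach x Y ps)).length) * (Real.logb 2 n + 2) := by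
  induction ps with
  | nil => simp [detach, weight, allPts]
  | cons p ps ih =>
    rw [allPts_cons, List.length_append] at hn
    have ih := ih (by omega)
    have hf := List.length_filter_le (fun y => decide (y ≠ x ∧ y ∉ Y)) p.pts
    have h1 := xlog_sub_le hf (by omega : p.pts.length ≤ n)
    have h2 : weight (detach x Y (p :: ps)) =
        xlog (p.pts.filter fun y => decide (y ≠ x ∧ y ∉ Y)).length + weight (detach x Y ps) := by
      simp only [detach, List.map_cons, List.filter_cons]
      split
      · rw [weight_cons]
      · rename_i h
        have : p.pts.filter (fun y => decide (y ≠ x ∧ y ∉ Y)) = [] := by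
          simpa only [Bool.not_eq_true', Bool.not_eq_false, List.isEmpty_iff] using h
        rw [this]
        simp [xlog]
    rw [weight_cons, h2, allPts_detach, allPts_cons, List.filter_append, List.length_append,
      List.length_append, ← allPts_detach]
    push_cast
    linarith

/-- An upper bound on the number of edges that does not grow when parts are merged. -/
def edgeCap (ps : List (Part α)) : ℕ :=
  (ps.map fun p => max p.edges.length (2 * p.pts.length)).sum

theorem edgeCap_cons (p : Part α) (ps : List (Part α)) :
    edgeCap (p :: ps) = max p.edges.length (2 * p.pts.length) + edgeCap ps := by
  simp [edgeCap]

theorem length_allEdges_le_edgeCap (ps : List (Part α)) :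
    (allEdges ps).length ≤ edgeCap ps := by
  induction ps with
  | nil => simp [allEdges]
  | cons p ps ih =>
    rw [allEdges_cons, edgeCap_cons, List.length_append]
    omega

theorem edgeCap_le (ps : List (Part α)) :
    edgeCap ps ≤ (allEdges ps).length + 2 * (allPts ps).length := by
  induction ps with
  | nil => simp [edgeCap]
  | cons p ps ih =>
    rw [allEdges_cons, allPts_cons, edgeCap_cons, List.length_append, List.length_append]
    omega

theorem Inv.partsCells_le {d : α → α → β} {S R : List α} {ps : List (Part α)}
    (h : Inv d S R ps) : partsCells ps ≤ (allEdges ps).length + 2 * S.length := by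
  have := h.length_eq
  have := h.length_parts_le
  unfold partsCells
  omega

/-- The potential of a list of parts of a set of `n` objects. It pays for merging (first term)
and for rebuilding (second term). -/
noncomputable def potential (n : ℕ) (ps : List (Part α)) : ℝ :=
  380 * (n * (xlog n - weight ps)) + 22 * (n * max 0 (((allEdges ps).length : ℝ) - n))

theorem Inv.potential_nonneg {d : α → α → β} {S R : List α} {ps : List (Part α)}
    (h : Inv d S R ps) : 0 ≤ potential S.length ps := by
  have h1 := sub_nonneg.2 h.weight_le
  have h2 : (0 : ℝ) ≤ max 0 (((allEdges ps).length : ℝ) - S.length) := le_max_left _ _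
  unfold potential
  positivity

/-! ### Merging and rebuilding -/

variable [DecidableEq α]

/-- Time and new edges are both charged to the gain in `weight`. The edge count itself may grow
under merging, so space is controlled by `edgeCap`: a new path on `I` has fewer than `2|I|` edges,
within the allowance that the merged parts already had. -/
theorem mergeParts_spec {d : α → α → β} (hd : ∀ s t, d s t = d t s) {S : List α} :
    ∀ (fuel : ℕ) (ps : List (Part α)), Inv d S [] ps → ps.length ≤ fuel →
    ps.length ≤ Nat.log 2 S.length + 2 →
    (mergeParts d S fuel ps).Spec fun ps' c => Inv d S [] ps' ∧
      (ps'.length ≤ Nat.log 2 S.length ∨ ps'.length ≤ 1) ∧ weight ps ≤ weight ps' ∧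
      ((allEdges ps').length : ℝ) ≤ (allEdges ps).length + 10 * (weight ps' - weight ps) ∧
      (c.time : ℝ) ≤ 160 * (S.length * (weight ps' - weight ps)) + 3 * S.length + 1 ∧
      edgeCap ps' ≤ edgeCap ps ∧ c.space ≤ edgeCap ps + 6 * S.length := by
  intro fuel
  induction fuel with
  | zero =>
    intro ps h hf _
    refine Prog.spec_pure ⟨h, Or.inr (by omega), le_rfl, by simp, ?_, le_rfl, by simp⟩
    simp only [sub_self, mul_zero, Nat.cast_zero]
    positivity
  | succ fuel ih =>
    intro ps h hf hk
    have hkn := h.length_parts_le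
    have hlog : Nat.log 2 S.length ≤ S.length := Nat.log_le_self 2 _
    refine Prog.spec_charge_bind ?_
    split
    · rename_i hdone
      refine Prog.spec_pure ⟨h, hdone, le_rfl, by simp, ?_, le_rfl, by simp⟩
      simp only [sub_self, mul_zero, add_zero, zero_add]
      exact_mod_cast (by omega :
        S.length + ps.length + Nat.log 2 S.length + 1 ≤ 3 * S.length + 1)
    · rename_i hdone
      rw [not_or, not_le, not_le] at hdone
      refine Prog.spec_charge_bind (Prog.spec_choose_bind (exists_isBestSplit hdone.2) ?_)
      rintro ⟨A, B, rest⟩ hr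
      have hr : IsBestSplit ps A B rest := hr
      have hn : 0 < S.length := by omega
      have hlen := h.length_eq
      simp only [List.length_nil, zero_add] at hlen
      have hB4 := hr.le_four_mul h.ne_nil hlen.le hdone.1 hdone.2
      have hA : 0 < A.pts.length := List.length_pos_of_ne_nil (h.ne_nil A hr.1.mem_left)
      have hI := h.split hr.1
      refine (addPart_spec hd hI).bind ?_
      rintro ps' c₁ ⟨hinv, hps', hct, hcs⟩
      have hIne : A.pts ++ B.pts ≠ [] := by
        intro h'
        have := congrArg List.length h'
        simp at this
        simp [this] at hA
      obtain ⟨-, E, rfl, hE, -⟩ := hps'.resolve_left fun h' => hIne h'.1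
      have hplen : ps.length = rest.length + 2 := by simpa using hr.1.1.length_eq
      simp only [List.length_append] at hE hct
      have hcap : edgeCap ps = edgeCap (A :: B :: rest) := (hr.1.1.map _).sum_eq
      simp only [edgeCap_cons] at hcap
      have hcap' : edgeCap (⟨A.pts ++ B.pts, E⟩ :: rest) ≤ edgeCap ps := by
        simp only [edgeCap_cons, List.length_append]
        omega
      have hedge : (allEdges ps).length = (allEdges (A :: B :: rest)).length :=
        (hr.1.1.flatMap_right _).length_eq
      simp only [allEdges_cons, List.length_append] at hedge
      have hw : weight ps = weight (A :: B :: rest) := weight_perm hr.1.1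
      simp only [weight_cons] at hw
      have hgain : weight ps + A.pts.length ≤ weight (⟨A.pts ++ B.pts, E⟩ :: rest) := by
        have := xlog_add_add_le hA hr.2.1
        rw [weight_cons, hw]
        simp only [List.length_append]
        linarith
      refine (ih _ hinv ?_ ?_).mono ?_
      · simp only [List.length_cons]; omega
      · simp only [List.length_cons]; omega
      rintro qs c₂ ⟨hq1, hq2, hq3, hq4, hq5, hq6, hq7⟩
      have hAr : (B.pts.length : ℝ) ≤ 4 * A.pts.length := by exact_mod_cast hB4
      have hA0 : (0 : ℝ) ≤ A.pts.length := Nat.cast_nonneg _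
      refine ⟨hq1, hq2, by linarith, ?_, ?_, by omega, ?_⟩
      · have h1 : (allEdges (⟨A.pts ++ B.pts, E⟩ :: rest)).length ≤
            (allEdges ps).length + 2 * (A.pts.length + B.pts.length) := by
          simp only [allEdges_cons, List.length_append]
          omega
        have h1' : ((allEdges (⟨A.pts ++ B.pts, E⟩ :: rest)).length : ℝ) ≤
            (allEdges ps).length + 2 * (A.pts.length + B.pts.length) := by exact_mod_cast h1
        linarith
      · have hsq := sq_le_of_le_log_add_two hn hk
        have hm : S.length ≤ S.length * (A.pts.length + B.pts.length) :=
          Nat.le_mul_of_pos_right _ (by omega)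
        have hlog' : Nat.log 2 S.length < S.length := Nat.log_lt_self 2 hn.ne'
        -- With `m` the size of the merged part: at most `3n` for the loop test, `5n` for the pairs,
        -- `n` for the objects and `22nm + 1` for the path, together at most `32nm`. As `m` is at
        -- most 5 times the gain, this gives the factor 160.
        have ht : S.length + ps.length + Nat.log 2 S.length + 1 +
            (ps.length ^ 2 + (allPts ps).length + c₁.time) ≤
            32 * (S.length * (A.pts.length + B.pts.length)) := by omega
        have ht' : (S.length + ps.length + Nat.log 2 S.length + 1 +
            (ps.length ^ 2 + (allPts ps).length + c₁.time) : ℝ) ≤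
            32 * (S.length * (A.pts.length + B.pts.length)) := by exact_mod_cast ht
        have hS0 : (0 : ℝ) ≤ S.length := Nat.cast_nonneg _
        have h5 : (S.length : ℝ) * (A.pts.length + B.pts.length) ≤
            S.length * (5 * (weight (⟨A.pts ++ B.pts, E⟩ :: rest) - weight ps)) :=
          mul_le_mul_of_nonneg_left (by linarith) hS0
        push_cast
        linarith
      · have h1 := hI.partsCells_le
        have h2 := length_allEdges_le_edgeCap rest
        simp only
        omega

/-- A rebuild happens only when the excess of edges over `n` is at least `n`. The potential then
released, `22n²`, matches the cost of the new path, and afterwards the potential is zero. -/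
theorem rebuildIfNeeded_spec {d : α → α → β} (hd : ∀ s t, d s t = d t s) {S : List α}
    {ps : List (Part α)} (h : Inv d S [] ps) :
    (rebuildIfNeeded d S ps).Spec fun ps' c => Inv d S [] ps' ∧
      (ps' = ps ∨ ps'.length ≤ 1) ∧ (allEdges ps').length ≤ 2 * S.length ∧
      (c.time : ℝ) + potential S.length ps' ≤ potential S.length ps +
        S.length + (allEdges ps).length + ps.length + 2 ∧
      c.space ≤ 4 * S.length := by
  refine Prog.spec_charge_bind ?_
  split
  · rename_i hle
    refine (addPart_spec hd (Inv.single h.nodup)).mono ?_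
    rintro ps' c ⟨hinv, hps', hct, hcs⟩
    have hstat : ps'.length ≤ 1 ∧ (allEdges ps').length ≤ S.length ∧
        weight ps' = xlog S.length := by
      rcases hps' with ⟨rfl, rfl⟩ | ⟨-, E, rfl, -, hE⟩
      · simp [allEdges, weight, xlog]
      · refine ⟨by simp, ?_, by simp [weight]⟩
        simp only [allEdges_cons, List.length_append]
        simp [allEdges]
        omega
    obtain ⟨h1, h2, h3⟩ := hstat
    refine ⟨hinv, Or.inr h1, by omega, ?_, by simpa [partsCells, allPts, allEdges] using hcs⟩
    have hpot : potential S.length ps' = 0 := by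
      have : ((allEdges ps').length : ℝ) - S.length ≤ 0 := sub_nonpos.2 (by exact_mod_cast h2)
      rw [potential, h3, max_eq_left this]
      ring
    have hS0 : (0 : ℝ) ≤ S.length := Nat.cast_nonneg _
    have hle' : (2 : ℝ) * S.length ≤ (allEdges ps).length := by exact_mod_cast hle
    have hmax : (S.length : ℝ) ≤ max 0 (((allEdges ps).length : ℝ) - S.length) :=
      le_max_of_le_right (by linarith)
    have h4 := mul_le_mul_of_nonneg_left hmax hS0
    have h5 := mul_nonneg hS0 (sub_nonneg.2 h.weight_le)
    have hct' : (c.time : ℝ) ≤ 22 * (S.length * S.length) + 1 := by exact_mod_cast hct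
    rw [hpot, potential]
    push_cast
    linarith
  · rename_i hle
    refine Prog.spec_pure ⟨h, Or.inl rfl, by omega, ?_, by simp⟩
    push_cast
    linarith

/-- The 380 in `potential` is `160 + 22 * 10`: the time of a merge plus the potential of the edges
it adds. The leading constant 66 is `22 + 22 * 2`: the time for the part on `I` plus the potential
of its at most `2|I|` edges. The slack in `hk` and `he` allows for `n` having just dropped by one.
-/
theorem finish_spec {d : α → α → β} (hd : ∀ s t, d s t = d t s) {S I : List α}
    {ps : List (Part α)} (h : Inv d S I ps) (hk : ps.length ≤ Nat.log 2 S.length + 1)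
    (he : (allEdges ps).length ≤ 2 * S.length + 2) :
    (finish d S I ps).Spec fun σ c => σ.objs = S ∧ Inv d S [] σ.parts ∧
      IsClosestPair d S.toFinset σ.best ∧
      (σ.parts.length ≤ Nat.log 2 S.length ∨ σ.parts.length ≤ 1) ∧
      (allEdges σ.parts).length ≤ 2 * S.length ∧
      (c.time : ℝ) + potential S.length σ.parts ≤
        potential S.length ps + 66 * ((S.length + 1) * (I.length + 1)) ∧
      c.space ≤ 10 * S.length + 2 := by
  have hlen := h.length_eq
  have hcells := h.partsCells_le
  refine (addPart_spec hd h).bind ?_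
  rintro ps₁ c₁ ⟨hinv₁, hps₁, hct₁, hcs₁⟩
  have hstat : ps₁.length ≤ ps.length + 1 ∧ weight ps ≤ weight ps₁ ∧
      (allEdges ps₁).length ≤ (allEdges ps).length + 2 * I.length ∧
      edgeCap ps₁ ≤ 4 * S.length + 2 := by
    have hcap := edgeCap_le ps
    rcases hps₁ with ⟨-, rfl⟩ | ⟨-, E, rfl, hE, -⟩
    · refine ⟨by omega, le_rfl, by omega, by omega⟩
    · refine ⟨by simp, ?_, ?_, ?_⟩
      · rw [weight_cons]
        linarith [xlog_nonneg I.length]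
      · simp only [allEdges_cons, List.length_append]
        omega
      · simp only [edgeCap_cons]
        omega
  obtain ⟨hk₁, hw₁, he₁, hcap₁⟩ := hstat
  refine (mergeParts_spec hd ps₁.length ps₁ hinv₁ le_rfl (by omega)).bind ?_
  rintro ps₂ c₂ ⟨hinv₂, hk₂, hw₂, he₂, hct₂, hcap₂, hcs₂⟩
  have hel₂ := length_allEdges_le_edgeCap ps₂
  have hkn₂ := hinv₂.length_parts_le
  refine (rebuildIfNeeded_spec hd hinv₂).bind ?_
  rintro ps₃ c₃ ⟨hinv₃, hk₃, he₃, hct₃, hcs₃⟩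
  have hkn₃ := hinv₃.length_parts_le
  have hcells₃ := hinv₃.partsCells_le
  refine (scan_spec hd hinv₃).mono ?_
  rintro σ c₄ ⟨hobj, hparts, hbest, hct₄, hcs₄⟩
  rw [hparts]
  refine ⟨hobj, hinv₃, hbest, ?_, he₃, ?_, ?_⟩
  · rcases hk₃ with rfl | hk₃
    · exact hk₂
    · exact Or.inr hk₃
  · have hS0 : (0 : ℝ) ≤ S.length := Nat.cast_nonneg _
    have hI0 : (0 : ℝ) ≤ I.length := Nat.cast_nonneg _
    have t₁ : (c₁.time : ℝ) ≤ 22 * (S.length * I.length) + 1 := by exact_mod_cast hct₁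
    have t₄ : (c₄.time : ℝ) ≤ 9 * S.length + 2 := by
      exact_mod_cast (by omega : c₄.time ≤ 9 * S.length + 2)
    have e₂ : ((allEdges ps₂).length : ℝ) + ps₂.length ≤ 5 * S.length + 2 := by
      exact_mod_cast (by omega : (allEdges ps₂).length + ps₂.length ≤ 5 * S.length + 2)
    have he₁' : ((allEdges ps₁).length : ℝ) ≤ (allEdges ps).length + 2 * I.length := by
      exact_mod_cast he₁
    have hmax : max 0 (((allEdges ps₂).length : ℝ) - S.length) ≤
        max 0 (((allEdges ps).length : ℝ) - S.length) + 2 * I.length +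
          10 * (weight ps₂ - weight ps₁) := by
      have m1 := le_max_left 0 (((allEdges ps).length : ℝ) - S.length)
      have m2 := le_max_right 0 (((allEdges ps).length : ℝ) - S.length)
      refine max_le ?_ ?_ <;> linarith
    have hmul := mul_le_mul_of_nonneg_left hmax hS0
    have hmw := mul_le_mul_of_nonneg_left hw₁ hS0
    have hSI := mul_nonneg hS0 hI0
    simp only [potential] at hct₃ ⊢
    push_cast
    linarith
  · simp only
    omega

end

section

variable {α : Type u} [DecidableEq α] {β : Type v} [LinearOrder β]

/-! ### States and updates -/

/-- The invariant of the data structure between updates. -/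
structure StateInv (d : α → α → β) (S : Finset α) (σ : Conga α) : Prop where
  inv : Inv d σ.objs [] σ.parts
  toFinset_eq : σ.objs.toFinset = S
  length_parts : σ.parts.length ≤ Nat.log 2 σ.objs.length ∨ σ.parts.length ≤ 1
  length_edges : (allEdges σ.parts).length ≤ 2 * σ.objs.length
  closest : IsClosestPair d S σ.best

theorem StateInv.card_eq {d : α → α → β} {S : Finset α} {σ : Conga α} (h : StateInv d S σ) :
    S.card = σ.objs.length := by
  rw [← h.toFinset_eq, List.toFinset_card_of_nodup h.inv.nodup]

theorem StateInv.cells_le {d : α → α → β} {S : Finset α} {σ : Conga α} (h : StateInv d S σ) :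
    σ.cells ≤ 5 * σ.objs.length + 1 := by
  have := h.inv.partsCells_le
  have := h.length_edges
  unfold Conga.cells
  omega

theorem StateInv.represents {d : α → α → β} {S : Finset α} {σ : Conga α} (h : StateInv d S σ) :
    σ.Represents S := by
  refine ⟨h.inv.nodup, h.toFinset_eq, by simpa using h.inv.perm, fun p hp => ?_, fun h2 => ?_⟩
  · refine ⟨h.inv.ne_nil p hp, h.inv.path p hp, fun e he => ?_⟩
    rw [← h.toFinset_eq, List.mem_toFinset, List.mem_toFinset]
    exact h.inv.mem p hp e he
  · rw [h.card_eq] at h2 ⊢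
    have h1 : σ.parts.length ≤ Nat.log 2 σ.objs.length := by
      have : 0 < Nat.log 2 σ.objs.length := Nat.log_pos (by norm_num) h2
      -- For `n ≥ 2` the logarithm is at least 1, so a single part is within the bound too.
      rcases h.length_parts with h' | h' <;> omega
    calc (σ.parts.length : ℝ) ≤ (Nat.log 2 σ.objs.length : ℝ) := by exact_mod_cast h1
      _ ≤ Real.logb 2 σ.objs.length := by
        simpa using Real.natLog_le_logb σ.objs.length 2

/-- The potential of a state. -/
noncomputable def Conga.potential (σ : Conga α) : ℝ :=
  CongaLine.potential σ.objs.length σ.parts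

theorem initStruct_spec {d : α → α → β} (hd : ∀ s t, d s t = d t s) {S : List α}
    (hS : S.Nodup) :
    (initStruct d S).Spec fun σ c => StateInv d S.toFinset σ ∧ σ.potential = 0 ∧
      c.time ≤ 22 * (S.length * S.length) + 9 * S.length + 3 ∧ c.space ≤ 5 * S.length + 1 := by
  refine (addPart_spec hd (Inv.single hS)).bind ?_
  rintro ps c₁ ⟨hinv, hps, hct₁, hcs₁⟩
  obtain ⟨h1, h2, h3⟩ : ps.length ≤ 1 ∧ (allEdges ps).length ≤ S.length ∧
      weight ps = xlog S.length := by
    rcases hps with ⟨rfl, rfl⟩ | ⟨-, E, rfl, -, hE⟩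
    · simp [allEdges, weight, xlog]
    · refine ⟨by simp, ?_, by simp [weight]⟩
      simp only [allEdges_cons, List.length_append]
      simp [allEdges]
      omega
  refine (scan_spec hd hinv).mono ?_
  rintro σ c ⟨rfl, rfl, hbest, hct, hcs⟩
  have hk := hinv.length_parts_le
  have hc := hinv.partsCells_le
  have hcs₁' : c₁.space ≤ 4 * σ.objs.length := by simpa [partsCells, allPts, allEdges] using hcs₁
  refine ⟨⟨hinv, rfl, Or.inr h1, by omega, hbest⟩, ?_, ?_, ?_⟩
  · have : ((allEdges σ.parts).length : ℝ) - σ.objs.length ≤ 0 := sub_nonpos.2 (by exact_mod_cast h2)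
    rw [Conga.potential, CongaLine.potential, h3, max_eq_left this]
    ring
  · simp only at hct ⊢
    omega
  · simp only at hcs ⊢
    omega

/-! ### Amortized cost of the updates -/

theorem insertObj_spec {d : α → α → β} (hd : ∀ s t, d s t = d t s) {S : Finset α} {σ : Conga α}
    (h : StateInv d S σ) {x : α} (hx : x ∉ S) :
    (insertObj d x σ).Spec fun σ' c => StateInv d (insert x S) σ' ∧
      (c.time : ℝ) + σ'.potential ≤ σ.potential + 3000 * (Op.insert x).bound S ∧
      c.space ≤ 3000 * (S.card + 1) := by
  have hcard := h.card_eq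
  have hk := h.inv.length_parts_le
  have hcells := h.cells_le
  have hxo : x ∉ σ.objs := fun h' => hx (by rw [← h.toFinset_eq]; exact List.mem_toFinset.2 h')
  -- The old digraphs need not know about `x`: it is unassigned and will lie in the newest part.
  have hinv : Inv d (x :: σ.objs) [x] σ.parts :=
    ⟨List.nodup_cons.2 ⟨hxo, h.inv.nodup⟩, by simpa using h.inv.perm, h.inv.ne_nil, h.inv.path,
      fun p hp e he => ⟨List.mem_cons_of_mem _ (h.inv.mem p hp e he).1,
        List.mem_cons_of_mem _ (h.inv.mem p hp e he).2⟩, h.inv.covers_self, h.inv.covers_later⟩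
  have hlk : σ.parts.length ≤ Nat.log 2 (x :: σ.objs).length + 1 := by
    have := Nat.log_mono_right (b := 2) (Nat.le_add_right σ.objs.length 1)
    rw [List.length_cons]
    rcases h.length_parts with h' | h' <;> omega
  have hle := h.length_edges
  refine Prog.spec_charge_bind (Prog.spec_live_bind ((finish_spec hd hinv hlk
    (by rw [List.length_cons]; omega)).mono ?_))
  rintro ⟨objs, parts, best⟩ c ⟨rfl, hinv', hbest, hk', he', hct, hcs⟩
  have hfin : (x :: σ.objs).toFinset = insert x S := by rw [List.toFinset_cons, h.toFinset_eq]
  refine ⟨⟨hinv', hfin, hk', he', hfin ▸ hbest⟩, ?_, ?_⟩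
  · simp only [Conga.potential, Op.bound, hcard, List.length_cons, List.length_nil] at hct ⊢
    set n := σ.objs.length
    have hn0 : (0 : ℝ) ≤ n := Nat.cast_nonneg _
    set l := Real.logb 2 ((n : ℝ) + 2) with hl
    have hl1 : 1 ≤ l := by
      rw [hl, Real.le_logb_iff_rpow_le (by norm_num) (by linarith)]
      norm_num
    have hlN : Real.logb 2 ((n + 1 : ℕ) : ℝ) ≤ l := by
      refine (logb_two_natCast_mono (Nat.le_succ (n + 1))).trans_eq ?_
      rw [hl]; congr 1; push_cast; ring
    -- The potential grows in two ways: `n` times this increment, and one more copy of `xlog (n +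
    -- 1)` from the larger prefactor. Both are `O(n log n)`.
    have hx1 : xlog (n + 1) - xlog n ≤ l + 2 := by
      have := xlog_sub_le (Nat.le_succ n) (le_refl (n + 1))
      push_cast at this hlN
      simp only [Nat.succ_eq_add_one] at this
      linarith
    have hx2 : xlog (n + 1) ≤ (n + 1) * l := by
      have := mul_le_mul_of_nonneg_left hlN (by positivity : (0 : ℝ) ≤ n + 1)
      rw [xlog]
      exact_mod_cast this
    have hx3 := mul_le_mul_of_nonneg_left hx1 hn0
    have hw := weight_nonneg σ.parts
    have hM : max 0 (((allEdges σ.parts).length : ℝ) - (n + 1)) ≤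
        max 0 (((allEdges σ.parts).length : ℝ) - n) := max_le_max le_rfl (by linarith)
    have hM' : max 0 (((allEdges σ.parts).length : ℝ) - n) ≤ n := by
      have : ((allEdges σ.parts).length : ℝ) ≤ 2 * n := by exact_mod_cast hle
      exact max_le hn0 (by linarith)
    have hM2 := mul_le_mul_of_nonneg_left hM (by positivity : (0 : ℝ) ≤ n + 1)
    have hnl : (n : ℝ) ≤ n * l := le_mul_of_one_le_right hn0 hl1
    simp only [CongaLine.potential] at hct ⊢
    push_cast at hct ⊢
    nlinarith
  · rw [hcard]
    simp only [List.length_cons] at hcs ⊢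
    omega

theorem deleteObj_spec {d : α → α → β} (hd : ∀ s t, d s t = d t s) {S : Finset α} {σ : Conga α}
    (h : StateInv d S σ) {x : α} (hx : x ∈ S) :
    (deleteObj d x σ).Spec fun σ' c => StateInv d (S.erase x) σ' ∧
      (c.time : ℝ) + σ'.potential ≤ σ.potential + 3000 * (Op.delete x).bound S ∧
      c.space ≤ 3000 * (S.card + 1) := by
  have hcard := h.card_eq
  have hk := h.inv.length_parts_le
  have hcells := h.cells_le
  have hle := h.length_edges
  have hlen := h.inv.length_eq
  simp only [List.length_nil, zero_add] at hlen
  have hxo : x ∈ σ.objs := by rw [← h.toFinset_eq] at hx; exact List.mem_toFinset.1 hx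
  have hpos := List.length_pos_of_mem hxo
  have hN : (σ.objs.erase x).length + 1 = σ.objs.length := by
    rw [List.length_erase_of_mem hxo]; omega
  have hinv := h.inv.detach x
  have hY := length_preds_le (x := x) h.inv.path
  have hYd : (preds x σ.parts).dedup.length ≤ (preds x σ.parts).length :=
    (List.dedup_sublist _).length_le
  have hdl := length_detach_le x (preds x σ.parts) σ.parts
  have hde := length_allEdges_detach_le x (preds x σ.parts) σ.parts
  have hdlen := hinv.length_eq
  have hw := weight_le_weight_detach x (preds x σ.parts) hlen.le
  have hlk : (detach x (preds x σ.parts) σ.parts).length ≤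
      Nat.log 2 (σ.objs.erase x).length + 1 := by
    rcases h.length_parts with h' | h'
    · have h1 : Nat.log 2 σ.objs.length ≤ Nat.log 2 (σ.objs.erase x).length + 1 := by
        rcases Nat.eq_zero_or_pos (σ.objs.erase x).length with h0 | h0
        · rw [← hN, h0]; simp
        · rw [← Nat.log_mul_base (by norm_num) h0.ne']
          exact Nat.log_mono_right (by omega)
      omega
    · omega
  refine Prog.spec_live_bind (Prog.spec_charge_bind (Prog.spec_charge_bind (Prog.spec_charge_bind
    ((finish_spec hd hinv hlk (by omega)).mono ?_))))
  rintro ⟨objs, parts, best⟩ c ⟨rfl, hinv', hbest, hk', he', hct, hcs⟩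
  have hfin : (σ.objs.erase x).toFinset = S.erase x := by
    ext y
    rw [List.mem_toFinset, h.inv.nodup.mem_erase_iff, Finset.mem_erase, ← h.toFinset_eq,
      List.mem_toFinset]
  refine ⟨⟨hinv', hfin, hk', he', hfin ▸ hbest⟩, ?_, ?_⟩
  · have hxl : xlog (σ.objs.erase x).length ≤ xlog σ.objs.length := xlog_mono (by omega)
    have hwN := hinv.weight_le
    have hpr : (σ.parts.length : ℝ) ≤ Real.logb 2 ((σ.objs.length : ℝ) + 1) := by
      have h1 : (1 : ℝ) ≤ Real.logb 2 ((σ.objs.length : ℝ) + 1) := by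
        have : (1 : ℝ) ≤ σ.objs.length := by exact_mod_cast hpos
        rw [Real.le_logb_iff_rpow_le (by norm_num) (by linarith)]
        norm_num
        linarith
      rcases h.length_parts with h' | h'
      · calc (σ.parts.length : ℝ) ≤ (Nat.log 2 σ.objs.length : ℝ) := by exact_mod_cast h'
          _ ≤ Real.logb 2 σ.objs.length := by simpa using Real.natLog_le_logb σ.objs.length 2
          _ ≤ Real.logb 2 ((σ.objs.length + 1 : ℕ) : ℝ) := logb_two_natCast_mono (Nat.le_succ _)
          _ = _ := by push_cast; rfl
      · exact le_trans (by exact_mod_cast h') h1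
    have htime : (allEdges σ.parts).length + σ.parts.length + 1 +
        ((preds x σ.parts).length ^ 2 + σ.objs.length + 1 +
        ((allPts σ.parts).length * ((preds x σ.parts).length + 2) +
          3 * (allEdges σ.parts).length + 2 * σ.parts.length + 1)) ≤
        17 * σ.objs.length + 2 * (σ.objs.length * (preds x σ.parts).length) := by
      have h2 : (preds x σ.parts).length ^ 2 ≤ σ.objs.length * (preds x σ.parts).length := by
        rw [sq]; exact Nat.mul_le_mul_right _ (by omega)
      rw [hlen, mul_add]
      omega
    have hcast : ((allEdges σ.parts).length + σ.parts.length + 1 +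
        ((preds x σ.parts).length ^ 2 + σ.objs.length + 1 +
        ((allPts σ.parts).length * ((preds x σ.parts).length + 2) +
          3 * (allEdges σ.parts).length + 2 * σ.parts.length + 1)) : ℝ) ≤
        17 * σ.objs.length + 2 * (σ.objs.length * (preds x σ.parts).length) := by
      exact_mod_cast htime
    have hNr : ((σ.objs.erase x).length : ℝ) + 1 = σ.objs.length := by exact_mod_cast hN
    have hYr : ((preds x σ.parts).length : ℝ) ≤ σ.parts.length := by exact_mod_cast hY
    have hmr : ((preds x σ.parts).dedup.length : ℝ) ≤ (preds x σ.parts).length := by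
      exact_mod_cast hYd
    have hdr : ((allEdges (detach x (preds x σ.parts) σ.parts)).length : ℝ) ≤
        (allEdges σ.parts).length := by exact_mod_cast hde
    have hdlr : ((preds x σ.parts).dedup.length : ℝ) +
        (allPts (detach x (preds x σ.parts) σ.parts)).length = (σ.objs.erase x).length := by
      exact_mod_cast hdlen
    have hremoved : ((allPts σ.parts).length : ℝ) -
        (allPts (detach x (preds x σ.parts) σ.parts)).length =
        (preds x σ.parts).dedup.length + 1 := by
      rw [hlen]; linarith
    rw [hremoved] at hw
    have hpos' : (1 : ℝ) ≤ σ.objs.length := by exact_mod_cast hpos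
    have hl0 := logb_two_natCast_nonneg σ.objs.length
    have hlN : Real.logb 2 σ.objs.length ≤ Real.logb 2 ((σ.objs.length : ℝ) + 1) :=
      Real.logb_le_logb_of_le (by norm_num) (by linarith) (by linarith)
    have hl1 : (1 : ℝ) ≤ Real.logb 2 ((σ.objs.length : ℝ) + 1) := by
      rw [Real.le_logb_iff_rpow_le (by norm_num) (by linarith)]
      norm_num
      linarith
    simp only [Conga.potential, Op.bound, hcard, CongaLine.potential] at hct ⊢
    push_cast at hct ⊢
    generalize Real.logb 2 ((σ.objs.length : ℝ) + 1) = l at *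
    generalize Real.logb 2 (σ.objs.length : ℝ) = l₀ at *
    generalize hm : ((preds x σ.parts).dedup.length : ℝ) = m at *
    have hm0 : 0 ≤ m := hm ▸ Nat.cast_nonneg _
    have hY0 : (0 : ℝ) ≤ (preds x σ.parts).length := Nat.cast_nonneg _
    generalize ((preds x σ.parts).length : ℝ) = y at *
    have hN0 : (0 : ℝ) ≤ (σ.objs.erase x).length := Nat.cast_nonneg _
    generalize hNN : ((σ.objs.erase x).length : ℝ) = N at *
    generalize hnn : (σ.objs.length : ℝ) = n at *
    set w := weight σ.parts
    set w' := weight (detach x (preds x σ.parts) σ.parts)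
    set M := max 0 (((allEdges σ.parts).length : ℝ) - n) with hMdef
    have hM0 : 0 ≤ M := le_max_left _ _
    -- The threshold falls by one with `n`, and no edge is added, so the excess grows by at most
    -- one.
    have hM : max 0 (((allEdges (detach x (preds x σ.parts) σ.parts)).length : ℝ) - N) ≤
        M + 1 := by
      have := le_max_right 0 (((allEdges σ.parts).length : ℝ) - n)
      refine max_le (by linarith) (by linarith)
    have a1 : N * max 0 (((allEdges (detach x (preds x σ.parts) σ.parts)).length : ℝ) - N) ≤
        n * M + n := by
      calc _ ≤ N * (M + 1) := mul_le_mul_of_nonneg_left hM hN0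
        _ ≤ n * (M + 1) := mul_le_mul_of_nonneg_right (by linarith) (by linarith)
        _ = _ := by ring
    have hml : m ≤ l := by linarith
    have hll : l ≤ l ^ 2 := by nlinarith
    -- The loss of `weight`: `m + 1` detached objects at `l₀ + 2` each, where `m`, `l₀` and 1 are
    -- all at most `l`. Multiplied by `380n`, this is the dominant term behind the constant 3000.
    have a2 : (m + 1) * (l₀ + 2) ≤ 6 * l ^ 2 := by
      calc (m + 1) * (l₀ + 2) ≤ (2 * l) * (3 * l) :=
            mul_le_mul (by linarith) (by linarith) (by linarith) (by linarith)
        _ = _ := by ring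
    have a3 : N * (xlog (σ.objs.erase x).length - w') ≤
        n * (xlog σ.objs.length - w) + 6 * (n * l ^ 2) := by
      calc _ ≤ n * (xlog (σ.objs.erase x).length - w') :=
            mul_le_mul_of_nonneg_right (by linarith) (by linarith)
        _ ≤ n * (xlog σ.objs.length - w + 6 * l ^ 2) :=
            mul_le_mul_of_nonneg_left (by linarith) (by linarith)
        _ = _ := by ring
    have a4 : n * y ≤ n * l ^ 2 := mul_le_mul_of_nonneg_left (by linarith) (by linarith)
    have a5 : n * m ≤ n * l ^ 2 := mul_le_mul_of_nonneg_left (by linarith) (by linarith)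
    have a6 : n ≤ n * l ^ 2 := le_mul_of_one_le_right (by linarith) (by linarith)
    rw [show N + 1 = n from hNr] at hct
    linarith
  · rw [hcard]
    simp only
    omega

theorem update_spec {d : α → α → β} (hd : ∀ s t, d s t = d t s) {S : Finset α} {σ : Conga α}
    (h : StateInv d S σ) {op : Op α} (hop : op.Valid S) :
    (update d op σ).Spec fun σ' c => StateInv d (op.apply S) σ' ∧
      (c.time : ℝ) + σ'.potential ≤ σ.potential + 3000 * op.bound S ∧
      c.space ≤ 3000 * (S.card + 1) := by
  cases op with
  | insert x => exact insertObj_spec hd h hop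
  | delete x => exact deleteObj_spec hd h hop

/-- The potentials telescope along the run. -/
theorem execute_spec {d : α → α → β} (hd : ∀ s t, d s t = d t s) (ops : List (Op α)) :
    ∀ {S : Finset α} {σ : Conga α}, StateInv d S σ → ValidAll S ops →
    (execute d ops σ).Spec fun σ' c => StateInv d (applyAll S ops) σ' ∧
      (c.time : ℝ) + σ'.potential ≤ σ.potential + 3000 * boundAll S ops := by
  induction ops with
  | nil =>
    intro S σ h _
    refine Prog.spec_pure ⟨h, ?_⟩
    simp [boundAll]
  | cons op ops ih =>
    intro S σ h hv
    refine (update_spec hd h hv.1).bind ?_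
    rintro σ' c ⟨h', ht, -⟩
    refine (ih h' hv.2).mono ?_
    rintro σ'' c' ⟨h'', ht'⟩
    refine ⟨h'', ?_⟩
    simp only [boundAll]
    push_cast
    linarith

end

end CongaLine

/-! ### The main theorem -/

theorem mainTheorem1 :
    ∃ C : ℝ, 0 < C ∧
      ∀ (α : Type u) [DecidableEq α] (β : Type v) [LinearOrder β] (d : α → α → β),
        (∀ s t, d s t = d t s) →
      ∀ S₀ : List α, S₀.Nodup →
        -- initialization
        (∃ σ₀ c₀, (CongaLine.initStruct d S₀).Yields σ₀ c₀) ∧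
        ∀ σ₀ c₀, (CongaLine.initStruct d S₀).Yields σ₀ c₀ →
          (c₀.time : ℝ) ≤ C * ((S₀.length : ℝ) + 1) ^ 2 ∧
          (c₀.space : ℝ) ≤ C * ((S₀.length : ℝ) + 1) ∧
          ∀ ops : List (CongaLine.Op α), CongaLine.ValidAll S₀.toFinset ops →
            ∀ σ c, (CongaLine.execute d ops σ₀).Yields σ c →
              -- correctness
              σ.Represents (CongaLine.applyAll S₀.toFinset ops) ∧
              CongaLine.IsClosestPair d (CongaLine.applyAll S₀.toFinset ops) σ.best ∧
              -- memory occupied between updates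
              (σ.cells : ℝ) ≤ C * (((CongaLine.applyAll S₀.toFinset ops).card : ℝ) + 1) ∧
              -- every further update can be carried out, and its memory peak
              (∀ op : CongaLine.Op α, op.Valid (CongaLine.applyAll S₀.toFinset ops) →
                (∃ σ' c', (CongaLine.update d op σ).Yields σ' c') ∧
                ∀ σ' c', (CongaLine.update d op σ).Yields σ' c' →
                  (c'.space : ℝ) ≤
                    C * (((CongaLine.applyAll S₀.toFinset ops).card : ℝ) + 1)) ∧
              -- total time of all updates
              (c.time : ℝ) ≤ C * CongaLine.boundAll S₀.toFinset ops := by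
  refine ⟨3000, by norm_num, ?_⟩
  intro α _ β _ d hd S₀ hS₀
  have hinit := CongaLine.initStruct_spec hd hS₀
  refine ⟨hinit.1, fun σ₀ c₀ hy => ?_⟩
  obtain ⟨h₀, hpot, ht, hs⟩ := hinit.2 σ₀ c₀ hy
  refine ⟨?_, ?_, fun ops hv σ c hrun => ?_⟩
  · have ht' : (c₀.time : ℝ) ≤ 22 * (S₀.length * S₀.length) + 9 * S₀.length + 3 := by
      exact_mod_cast ht
    nlinarith [(Nat.cast_nonneg S₀.length : (0 : ℝ) ≤ S₀.length)]
  · exact_mod_cast (by omega : c₀.space ≤ 3000 * (S₀.length + 1))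
  · obtain ⟨h, htime⟩ := (CongaLine.execute_spec hd ops h₀ hv).2 σ c hrun
    refine ⟨h.represents, h.closest, ?_, fun op hop => ?_, ?_⟩
    · have := h.cells_le
      rw [h.card_eq]
      exact_mod_cast (by omega : σ.cells ≤ 3000 * (σ.objs.length + 1))
    · have hu := CongaLine.update_spec hd h hop
      refine ⟨hu.1, fun σ' c' hy' => ?_⟩
      exact_mod_cast (hu.2 σ' c' hy').2.2
    -- The potential starts at zero and ends nonnegative, so the amortized total bounds the actual
    -- time.
    · have : 0 ≤ σ.potential := h.inv.potential_nonneg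
      rw [hpot] at htime
      linarith
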